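/- Let $n\ge 0$ and let $a_0,\dots,a_{n+1}$ be positive integers (in any order). Let $Y=\mathbf P^{n+1}(a_0,\dots,a_{n+1})=[(A^{n+2}-0)/\mathbf G_m]$ be the weighted projective stack over $\mathbf C$, where $t\in\mathbf G_m$ acts by $t(x_0,\dots,x_{n+1})=(t^{a_0}x_0,\dots,t^{a_{n+1}}x_{n+1})$. Let $S$ be an integral (that is, reduced and irreducible) closed substack of $Y$, of dimension $r$, with degree $\deg(S)=\int_S c_1(O(1))^r$. In coordinates $x_{n+1}=1$, $S$ corresponds to a closed subscheme $V(I)$ of $A^{n+1}$, where $I\subset\mathbf C[x_0,\dots,x_n]$ is obtained by setting $x_{n+1}=1$ in the ideal of the affine cone of $S$. Consider the weights $a=(a_0,\dots,a_n)$ on $A^{n+1}$. Let $\operatorname{mult}_a(S)$ be the weighted multiplicity of $V(I)$ at the origin, meaning the degree of the weighted tangent cone of $V(I)$ at the origin (the closed substack of $\mathbf P^n(a_0,\dots,a_n)$ defined by the lowest-weight parts of the elements of $I$) as a cycle of dimension $r-1$ in the stack $\mathbf P^n(a_0,\dots,a_n)$; if $r=0$, it means the length of the local ring of $V(I)$ at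 the origin. It is $0$ if $V(I)$ does not contain the origin. Then $$\operatorname{mult}_a(S)\le a_{n+1}\deg(S).$$ -/

import Mathlib

open MvPolynomial

noncomputable section

namespace WeightedStack

/-- The Krull dimension of the affine scheme `V(J) = Spec ℂ[x] / J`, as a natural number. (It is finite
for a polynomial ring in finitely many variables; the value for the empty scheme is `0`.) -/
def affineDim {m : ℕ} (J : Ideal (MvPolynomial (Fin m) ℂ)) : ℕ :=
  ((ringKrullDim (MvPolynomial (Fin m) ℂ ⧸ J)).unbotD 0).toNat

/-- An integral (that is, reduced and irreducible) closed substack of the weighted projective stack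
`P(a) = [(A^m - 0) / G_m]`, where `t • (x_i) = (t ^ a_i x_i)`. It is a `G_m`-invariant integral
closed subscheme of `A^m - 0`, and it is recorded by the ideal of its closure in `A^m` (the affine
cone): a prime ideal, homogeneous for the grading with `deg x_i = a_i`, whose zero set has a point
other than the origin. -/
structure IntegralClosedSubstack {m : ℕ} (a : Fin m → ℕ) where
  /-- The ideal of the affine cone. -/
  ideal : Ideal (MvPolynomial (Fin m) ℂ)
  isPrime : ideal.IsPrime
  isHomogeneous : ∀ f ∈ ideal, ∀ d : ℕ, weightedHomogeneousComponent a d f ∈ ideal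
  exists_X_notMem : ∃ i, X i ∉ ideal

/-- The affine cone of an integral closed substack, as a point of the spectrum. -/
def IntegralClosedSubstack.cone {m : ℕ} {a : Fin m → ℕ} (S : IntegralClosedSubstack a) :
    PrimeSpectrum (MvPolynomial (Fin m) ℂ) :=
  ⟨S.ideal, S.isPrime⟩

/-- The dimension of the substack: one less than the dimension of its affine cone. -/
def IntegralClosedSubstack.dim {m : ℕ} {a : Fin m → ℕ} (S : IntegralClosedSubstack a) : ℕ :=
  affineDim S.ideal - 1

/-- The length of the local ring of the closed subscheme `V(J)` at (the generic point of) `W`. -/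
def lengthAt {m : ℕ} (J : Ideal (MvPolynomial (Fin m) ℂ))
    (W : PrimeSpectrum (MvPolynomial (Fin m) ℂ)) : ℕ :=
  (Module.length (Localization.AtPrime W.asIdeal)
    (Localization.AtPrime W.asIdeal ⧸
      J.map (algebraMap (MvPolynomial (Fin m) ℂ) (Localization.AtPrime W.asIdeal)))).toNat

open Classical in
/-- The fundamental cycle `[V(J)]_k` of the closed subscheme `V(J)` of affine space, as a
function on integral closed subschemes: the coefficient of an irreducible component
of dimension `k` is the length of the local ring of `V(J)` at its generic point. -/
def fundamentalCycle {m : ℕ} (k : ℕ) (J : Ideal (MvPolynomial (Fin m) ℂ))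
    (W : PrimeSpectrum (MvPolynomial (Fin m) ℂ)) : ℕ :=
  if W.asIdeal ∈ J.minimalPrimes ∧ affineDim W.asIdeal = k then lengthAt J W else 0

open Classical in
/-- The order `gcd {a_i : x_i ≠ 0 on Z}` of the generic stabilizer of `G_m` acting with weights
`a` on the closed subset `Z` of affine space. -/
def stabilizerOrder {m : ℕ} (a : Fin m → ℕ) (Z : PrimeSpectrum (MvPolynomial (Fin m) ℂ)) : ℕ :=
  (Finset.univ.filter fun i => X i ∉ Z.asIdeal).gcd a

open Classical in
/-- The intersection number `∫_Z c₁(O(1))^r` for the `r`-dimensional integral closed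
substack of `P(a)` with affine cone `Z` (so `Z` has dimension `r + 1`).

A substack of dimension `0` is the classifying stack `Bμ_g` with `g` the order of
the stabilizer, so that `∫ 1 = 1 / g`. In dimension `r + 1`, choose a coordinate `x_i` that is not
identically zero on `Z`. It is a section of `O(a_i)`, so
`c₁(O(1)) ∩ [Z] = (1 / a_i) [div (x_i|_Z)]`, where the divisor of
`x_i|_Z` is the cycle of codimension `1` of the subscheme `Z ∩ {x_i = 0}`.
The choice of `x_i` does not matter, since the divisors of two sections of the same
line bundle are rationally equivalent. -/
def intersectionNumber {m : ℕ} (a : Fin m → ℕ) :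
    ℕ → PrimeSpectrum (MvPolynomial (Fin m) ℂ) → ℚ
  | 0, Z => 1 / (stabilizerOrder a Z : ℚ)
  | r + 1, Z =>
    if h : ∃ i, X i ∉ Z.asIdeal then
      (1 / (a h.choose : ℚ)) *
        ∑ᶠ W : PrimeSpectrum (MvPolynomial (Fin m) ℂ),
          (fundamentalCycle (r + 1) (Z.asIdeal ⊔ Ideal.span {X h.choose}) W : ℚ) *
            intersectionNumber a r W
    else 0

/-- The degree `∫_S c₁(O(1))^(dim S)` of an integral closed substack of `P(a)`. -/
def IntegralClosedSubstack.degree {m : ℕ} {a : Fin m → ℕ} (S : IntegralClosedSubstack a) : ℚ :=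
  intersectionNumber a S.dim S.cone

/-- The ideal, in the coordinates `x_0, …, x_n` of the chart `x_{n+1} = 1`, of the closed subscheme
of `A^{n+1}` that corresponds to `S`: put `x_{n+1} = 1` in all elements of the ideal of `S`. -/
def IntegralClosedSubstack.chartIdeal {n : ℕ} {a : Fin (n + 2) → ℕ}
    (S : IntegralClosedSubstack a) : Ideal (MvPolynomial (Fin (n + 1)) ℂ) :=
  S.ideal.map
    (aeval (Fin.snoc (α := fun _ => MvPolynomial (Fin (n + 1)) ℂ) X 1) :
      MvPolynomial (Fin (n + 2)) ℂ →ₐ[ℂ] MvPolynomial (Fin (n + 1)) ℂ)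

/-- The ideal of the `w`-weighted tangent cone at the origin of the closed subscheme `V(I)` of
affine space: it is generated by the lowest-weight parts of all elements of `I`. The quotient by it
is the associated graded ring of the filtration of `ℂ[x] / I` by weighted order, and the
corresponding substack of `P(w)` is the exceptional divisor of the weighted blow-up of `V(I)` at
the origin. -/
def tangentConeIdeal {m : ℕ} (w : Fin m → ℕ) (I : Ideal (MvPolynomial (Fin m) ℂ)) :
    Ideal (MvPolynomial (Fin m) ℂ) :=
  Ideal.span {g | ∃ f ∈ I, ∃ d : ℕ,
    (∀ e < d, weightedHomogeneousComponent w e f = 0) ∧ g = weightedHomogeneousComponent w d f}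

/-- The `w`-weighted multiplicity at the origin of a closed subscheme `V(I)` of affine space
of pure dimension `r` (the first numerical argument): the degree of its weighted tangent cone,
as an `(r - 1)`-dimensional cycle in `P(w)`. If `r = 0`, then it is the length of the local ring
at the origin, or equivalently of its associated graded ring (so a reduced point
has multiplicity `1`). It is `0` if `V(I)` does not contain the origin. -/
def weightedMultiplicity {m : ℕ} (w : Fin m → ℕ) :
    ℕ → Ideal (MvPolynomial (Fin m) ℂ) → ℚ
  | 0, I => (Module.finrank ℂ (MvPolynomial (Fin m) ℂ ⧸ tangentConeIdeal w I) : ℚ)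
  | r + 1, I =>
    ∑ᶠ W : PrimeSpectrum (MvPolynomial (Fin m) ℂ),
      (fundamentalCycle (r + 1) (tangentConeIdeal w I) W : ℚ) * intersectionNumber w r W

end WeightedStack

end

open MvPolynomial

noncomputable section

namespace WeightedStack

section Homogeneous

variable {m : ℕ}

/-! ### Krull dimension of quotients of polynomial rings -/

/-! Both sides are compared through Hilbert series. Let `P` be the ideal of the cone of `S`, `I` its
dehomogenization, `T` the weighted tangent cone ideal of `I`, `b = a_{n+1}`, `r = dim S`; let
`H_J(d)` be the dimension of the degree `d` part of the quotient by `J`.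

The heart is an inequality of partial sums. Consider the image in `ℂ[x_0, …, x_n] / I` of the
polynomials of weight at most `N`. Its dimension is at least `∑_{d ≤ N} H_T(d)`: lift each graded
piece of the quotient by `T` to homogeneous polynomials; if a nonzero sum of lifts were in `I`, its
lowest part would lie in `T`. On the other hand, a homogeneous `f` of weight `d ≤ N` becomes, after
multiplication by a power of `x_{n+1}`, homogeneous of a degree in the window `(N - b, N]`, so the
dimension is at most `∑_{N-b<d≤N} H_P(d)`. The latter is a partial sum of the coefficients of `(1 -
t^b) Hilb_P(t)`, and Abel summation gives `Hilb_T(t) ≤ (1 - t^b) Hilb_P(t)` for `0 ≤ t < 1`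
(`hilbSeries_tangentConeIdeal_le`).

Multiply by `(1 - t)^r` and let `t → 1` from below. The right side tends to `b deg(S)`, because the
degree is the leading coefficient of the Hilbert series (`tendsto_hilbSeries_intersectionNumber`).
The left side dominates the multiplicity asymptotically (`exists_lower_bound_hilbSeries`); this
one-sided bound needs no information on the dimension of the tangent cone.

Cycles and Hilbert series are matched by dévissage: for homogeneous `g ∉ J` of degree `e`, the exact
sequence `0 → R/(J:g)(-e) → R/J → R/(J+(g)) → 0` makes Hilbert series and local lengths additive,
which reduces statements to homogeneous primes (`homogeneous_induction`). -/

theorem ringKrullDim_quotient_ne_top (J : Ideal (MvPolynomial (Fin m) ℂ)) :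
    ringKrullDim (MvPolynomial (Fin m) ℂ ⧸ J) ≠ ⊤ := by
  have h := ringKrullDim_quotient_le J
  rw [MvPolynomial.ringKrullDim_of_isNoetherianRing, ringKrullDim_eq_zero_of_field, zero_add] at h
  intro h'
  rw [h', top_le_iff] at h
  simp only [Nat.card_eq_fintype_card, Fintype.card_fin] at h
  have h2 : ((m : ℕ∞) : WithBot ℕ∞) = ((⊤ : ℕ∞) : WithBot ℕ∞) := h
  exact ENat.natCast_ne_top m (WithBot.coe_injective h2)

theorem coe_affineDim {J : Ideal (MvPolynomial (Fin m) ℂ)} (hJ : J ≠ ⊤) :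
    ((affineDim J : ℕ∞) : WithBot ℕ∞) = ringKrullDim (MvPolynomial (Fin m) ℂ ⧸ J) := by
  have := Ideal.Quotient.nontrivial_iff.mpr hJ
  have h0 := ringKrullDim_nonneg_of_nontrivial (R := MvPolynomial (Fin m) ℂ ⧸ J)
  have h1 := ringKrullDim_quotient_ne_top J
  unfold affineDim
  generalize ringKrullDim (MvPolynomial (Fin m) ℂ ⧸ J) = x at *
  induction x with
  | bot => simp at h0
  | coe x =>
    rw [WithBot.unbotD_coe, ENat.natCast_toNat]
    rintro rfl
    exact h1 rfl

theorem affineDim_top : affineDim (⊤ : Ideal (MvPolynomial (Fin m) ℂ)) = 0 := by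
  unfold affineDim
  have : Subsingleton (MvPolynomial (Fin m) ℂ ⧸ (⊤ : Ideal (MvPolynomial (Fin m) ℂ))) :=
    Ideal.Quotient.subsingleton_iff.mpr rfl
  rw [ringKrullDim_eq_bot_of_subsingleton]
  simp

theorem affineDim_anti {J K : Ideal (MvPolynomial (Fin m) ℂ)} (h : J ≤ K) :
    affineDim K ≤ affineDim J := by
  by_cases hK : K = ⊤
  · rw [hK, affineDim_top]; exact Nat.zero_le _
  have hJ : J ≠ ⊤ := fun h' => hK (top_le_iff.mp (h' ▸ h))
  have := ringKrullDim_le_of_surjective (Ideal.Quotient.factor h)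
    (Ideal.Quotient.factor_surjective h)
  rw [← coe_affineDim hK, ← coe_affineDim hJ] at this
  exact_mod_cast this

theorem affineDim_lt {W J : Ideal (MvPolynomial (Fin m) ℂ)} (hW : W.IsPrime) (h : W < J)
    (hJ : J ≠ ⊤) : affineDim J < affineDim W := by
  obtain ⟨f, hfJ, hfW⟩ := SetLike.exists_of_lt h
  have := ringKrullDim_succ_le_of_surjective (Ideal.Quotient.factor h.le)
    (Ideal.Quotient.factor_surjective h.le) (r := Ideal.Quotient.mk W f)
    (mem_nonZeroDivisors_of_ne_zero (by rwa [ne_eq, Ideal.Quotient.eq_zero_iff_mem]))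
    (by rw [Ideal.Quotient.factor_mk, Ideal.Quotient.eq_zero_iff_mem]; exact hfJ)
  rw [← coe_affineDim hW.ne_top, ← coe_affineDim hJ] at this
  have h2 : affineDim J + 1 ≤ affineDim W := by exact_mod_cast this
  exact h2

/-- A smaller prime over `J` would have dimension strictly above that of `W`, hence above that of
`J`. -/
theorem mem_minimalPrimes_of_affineDim_le {W J : Ideal (MvPolynomial (Fin m) ℂ)}
    (hW : W.IsPrime) (h : J ≤ W) (hd : affineDim J ≤ affineDim W) : W ∈ J.minimalPrimes := by
  refine ⟨⟨hW, h⟩, fun Q hQ hQW => ?_⟩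
  by_contra hn
  have := affineDim_lt hQ.1 (lt_of_le_not_ge hQW hn) hW.ne_top
  exact absurd (affineDim_anti hQ.2) (by omega)

/-! ### Weighted homogeneous ideals -/

/-- An ideal that contains the weighted homogeneous components of its elements. -/
def IsWHom (a : Fin m → ℕ) (J : Ideal (MvPolynomial (Fin m) ℂ)) : Prop :=
  ∀ f ∈ J, ∀ d : ℕ, weightedHomogeneousComponent a d f ∈ J

variable {a : Fin m → ℕ} {J K W : Ideal (MvPolynomial (Fin m) ℂ)}

theorem isWHom_iff : letI := weightedGradedAlgebra ℂ a
    IsWHom a J ↔ J.IsHomogeneous (weightedHomogeneousSubmodule ℂ a) := by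
  let _ := weightedGradedAlgebra ℂ a
  constructor
  · intro h i f hf
    have := h f hf i
    rw [← weightedDecomposition.decompose'_apply] at this
    exact this
  · intro h f hf d
    exact weightedHomogeneousComponent_mem_of_mem ℂ a h hf d

/-- The homogeneous core of a prime is prime, and it still contains the homogeneous ideal `J`;
minimality forces it to equal `W`. -/
theorem isWHom_of_minimalPrimes (hJ : IsWHom a J) (hW : W ∈ J.minimalPrimes) : IsWHom a W := by
  let _ := weightedGradedAlgebra ℂ a
  rw [isWHom_iff] at hJ ⊢
  have hp := hW.1.1.homogeneousCore (𝒜 := weightedHomogeneousSubmodule ℂ a)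
  have hle := Ideal.toIdeal_homogeneousCore_le (weightedHomogeneousSubmodule ℂ a) W
  have hJ' : J ≤ (W.homogeneousCore (weightedHomogeneousSubmodule ℂ a)).toIdeal := by
    rw [← hJ.toIdeal_homogeneousCore_eq_self]
    exact Ideal.homogeneousCore_mono _ hW.1.2
  rw [le_antisymm (hW.2 ⟨hp, hJ'⟩ hle) hle]
  exact (W.homogeneousCore (weightedHomogeneousSubmodule ℂ a)).isHomogeneous

theorem weightedHomogeneousComponent_mul {g : MvPolynomial (Fin m) ℂ} {e : ℕ}
    (hg : IsWeightedHomogeneous a g e) (f : MvPolynomial (Fin m) ℂ) (d : ℕ) :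
    weightedHomogeneousComponent a (e + d) (g * f) = g * weightedHomogeneousComponent a d f := by
  classical
  induction f using MvPolynomial.induction_on' with
  | monomial u c =>
    have hm := isWeightedHomogeneous_monomial a u c rfl
    rw [weightedHomogeneousComponent_of_mem (hg.mul hm), weightedHomogeneousComponent_of_mem hm]
    by_cases h : d = Finsupp.weight a u <;> simp [h]
  | add p q hp hq => simp only [mul_add, map_add, hp, hq]

theorem weightedHomogeneousComponent_mul_of_lt {g : MvPolynomial (Fin m) ℂ} {e : ℕ}
    (hg : IsWeightedHomogeneous a g e) (f : MvPolynomial (Fin m) ℂ) {d : ℕ} (hd : d < e) :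
    weightedHomogeneousComponent a d (g * f) = 0 := by
  classical
  induction f using MvPolynomial.induction_on' with
  | monomial u c =>
    have hm := isWeightedHomogeneous_monomial a u c rfl
    rw [weightedHomogeneousComponent_of_mem (hg.mul hm), if_neg (by omega)]
  | add p q hp hq => simp only [mul_add, map_add, hp, hq, add_zero]

theorem IsWHom.sup_span {g : MvPolynomial (Fin m) ℂ} {e : ℕ} (hJ : IsWHom a J)
    (hg : IsWeightedHomogeneous a g e) : IsWHom a (J ⊔ Ideal.span {g}) := by
  let _ := weightedGradedAlgebra ℂ a
  rw [isWHom_iff] at hJ ⊢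
  refine hJ.sup (Ideal.homogeneous_span _ _ ?_)
  rintro x rfl
  exact ⟨e, hg⟩

/-- The colon ideal `(J : g)`. -/
def colon (J : Ideal (MvPolynomial (Fin m) ℂ)) (g : MvPolynomial (Fin m) ℂ) :
    Ideal (MvPolynomial (Fin m) ℂ) :=
  Submodule.comap (LinearMap.mulLeft (MvPolynomial (Fin m) ℂ) g) J

theorem mem_colon {g f : MvPolynomial (Fin m) ℂ} : f ∈ colon J g ↔ g * f ∈ J := Iff.rfl

theorem le_colon (g : MvPolynomial (Fin m) ℂ) : J ≤ colon J g :=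
  fun _ hf => J.mul_mem_left g hf

theorem IsWHom.colon {g : MvPolynomial (Fin m) ℂ} {e : ℕ} (hJ : IsWHom a J)
    (hg : IsWeightedHomogeneous a g e) : IsWHom a (colon J g) := by
  intro f hf d
  rw [mem_colon, ← weightedHomogeneousComponent_mul hg]
  exact hJ _ hf _

/-- Dévissage for weighted homogeneous ideals. -/
theorem homogeneous_induction {P : Ideal (MvPolynomial (Fin m) ℂ) → Prop} (htop : P ⊤)
    (hprime : ∀ W : Ideal (MvPolynomial (Fin m) ℂ), W.IsPrime → IsWHom a W → P W)
    (hstep : ∀ (J : Ideal (MvPolynomial (Fin m) ℂ)) (g : MvPolynomial (Fin m) ℂ) (e : ℕ),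
      IsWHom a J → IsWeightedHomogeneous a g e → g ∉ J →
      P (WeightedStack.colon J g) → P (J ⊔ Ideal.span {g}) → P J)
    (J : Ideal (MvPolynomial (Fin m) ℂ)) (hJ : IsWHom a J) : P J := by
  induction J using IsNoetherian.induction with
  | hgt J ih =>
  by_cases hT : J = ⊤
  · rwa [hT]
  by_cases hp : Ideal.IsPrime J
  · exact hprime J hp hJ
  let _ := weightedGradedAlgebra ℂ a
  have hJ' := isWHom_iff.mp hJ
  -- For a homogeneous ideal, failure of primality is witnessed by homogeneous `g`, `h` with `g * h
  -- ∈ J`. Then `h` enlarges `(J : g)` and `g` enlarges `J + (g)`, so Noetherian induction applies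
  -- to both.
  rw [hJ'.isPrime_iff] at hp
  push Not at hp
  obtain ⟨g, h, ⟨d, hg⟩, -, hgh, hgJ, hhJ⟩ := hp hT
  have hg : IsWeightedHomogeneous a g d := hg
  refine hstep J g d hJ hg hgJ (ih _ ?_ (hJ.colon hg)) (ih _ ?_ (hJ.sup_span hg))
  · exact lt_of_le_of_ne (le_colon g) fun he => hhJ (he ▸ mem_colon.mpr hgh)
  · refine lt_of_le_of_ne le_sup_left fun he => hgJ ?_
    rw [he]
    exact Ideal.mem_sup_right (Ideal.mem_span_singleton_self g)

/-! ### The irrelevant ideal -/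

/-- The ideal of polynomials without constant term. -/
def irrelevant (m : ℕ) : Ideal (MvPolynomial (Fin m) ℂ) :=
  RingHom.ker (constantCoeff (R := ℂ) (σ := Fin m))

instance : (irrelevant m).IsPrime := RingHom.ker_isPrime _

theorem X_mem_irrelevant (i : Fin m) : X i ∈ irrelevant m := by
  rw [irrelevant, RingHom.mem_ker, constantCoeff_X]

theorem IsWHom.le_irrelevant (ha : ∀ i, 0 < a i) (hJ : IsWHom a J) (hT : J ≠ ⊤) :
    J ≤ irrelevant m := by
  intro f hf
  have h := hJ f hf 0
  rw [weightedHomogeneousComponent_zero f (fun i => (ha i).ne')] at h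
  rw [irrelevant, RingHom.mem_ker, constantCoeff_eq]
  by_contra h0
  exact hT (Ideal.eq_top_of_isUnit_mem _ h ((isUnit_iff_ne_zero.mpr h0).map C))

/-- With positive weights every proper homogeneous ideal lies in the irrelevant ideal, and a strict
inclusion of primes lowers the dimension of the quotient. -/
theorem eq_irrelevant_of_affineDim_eq_zero (ha : ∀ i, 0 < a i) (hJ : IsWHom a W) (hW : W.IsPrime)
    (h0 : affineDim W = 0) : W = irrelevant m := by
  by_contra hne
  have := affineDim_lt hW (lt_of_le_of_ne (hJ.le_irrelevant ha hW.ne_top) hne)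
    (inferInstance : (irrelevant m).IsPrime).ne_top
  omega

theorem affineDim_pos_of_X_notMem (ha : ∀ i, 0 < a i) (hJ : IsWHom a W) (hW : W.IsPrime) {i : Fin m}
    (hi : X i ∉ W) : 0 < affineDim W := by
  by_contra h0
  rw [eq_irrelevant_of_affineDim_eq_zero ha hJ hW (by omega)] at hi
  exact hi (X_mem_irrelevant i)

theorem irrelevant_le_of_X_mem (h : ∀ i, X i ∈ J) : irrelevant m ≤ J := by
  intro f hf
  rw [irrelevant, RingHom.mem_ker, constantCoeff_eq] at hf
  rw [f.as_sum]
  refine J.sum_mem fun u hu => ?_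
  have hu0 : u ≠ 0 := by
    rintro rfl
    exact (mem_support_iff.mp hu) hf
  obtain ⟨i, hi⟩ := Finsupp.ne_iff.mp hu0
  have : monomial u (coeff u f) = monomial (u - Finsupp.single i 1) (coeff u f) * X i := by
    rw [X, monomial_mul, mul_one, tsub_add_cancel_of_le]
    rw [Finsupp.single_le_iff]
    exact Nat.one_le_iff_ne_zero.mpr hi
  rw [this]
  exact J.mul_mem_left _ (h i)

theorem affineDim_eq_zero_of_X_mem (h : ∀ i, X i ∈ J) : affineDim J = 0 := by
  have h1 := affineDim_anti (irrelevant_le_of_X_mem h)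
  have h2 : ringKrullDim (MvPolynomial (Fin m) ℂ ⧸ irrelevant m) = 0 := by
    unfold irrelevant
    rw [ringKrullDim_eq_of_ringEquiv (RingHom.quotientKerEquivOfSurjective
      (f := constantCoeff (R := ℂ) (σ := Fin m)) (fun c => ⟨C c, constantCoeff_C _ _⟩))]
    exact ringKrullDim_eq_zero_of_field ℂ
  have h3 : affineDim (irrelevant m) = 0 := by
    unfold affineDim
    rw [h2]
    rfl
  omega

end Homogeneous

/-! ### Hilbert functions and Hilbert series -/

section Hilbert

variable {m : ℕ} {a : Fin m → ℕ} {J K W : Ideal (MvPolynomial (Fin m) ℂ)}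

theorem finiteDimensional_weightedHomogeneousSubmodule (ha : ∀ i, 0 < a i) (d : ℕ) :
    FiniteDimensional ℂ (weightedHomogeneousSubmodule ℂ a d) :=
  Module.Finite.iff_fg.mpr (weightedHomogeneousSubmodule_fg ℂ a (fun i => (ha i).ne') d)

/-- Positive weights force each exponent to be at most `d`. The polynomial bound is crude, but
enough for the Hilbert series to converge on `[0, 1)`. -/
theorem finrank_weightedHomogeneousSubmodule_le (ha : ∀ i, 0 < a i) (d : ℕ) :
    Module.finrank ℂ (weightedHomogeneousSubmodule ℂ a d) ≤ (d + 1) ^ m := by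
  classical
  let E : Finset (Fin m →₀ ℕ) :=
    (Fintype.piFinset fun _ : Fin m => Finset.range (d + 1)).image Finsupp.equivFunOnFinite.symm
  let B : Finset (MvPolynomial (Fin m) ℂ) := E.image fun u => monomial u 1
  have hle : weightedHomogeneousSubmodule ℂ a d ≤ Submodule.span ℂ (B : Set _) := by
    intro f hf
    rw [f.as_sum]
    refine Submodule.sum_mem _ fun u hu => ?_
    have hw : Finsupp.weight a u = d := hf (mem_support_iff.mp hu)
    have h1 : monomial u (coeff u f) = coeff u f • (monomial u (1 : ℂ)) := by
      rw [smul_monomial, smul_eq_mul, mul_one]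
    rw [h1]
    refine Submodule.smul_mem _ _ (Submodule.subset_span ?_)
    simp only [B, E, Finset.coe_image, Set.mem_image]
    refine ⟨u, ⟨u, ?_, ?_⟩, rfl⟩
    · simp only [Finset.mem_coe, Fintype.mem_piFinset, Finset.mem_range]
      intro i
      have := Finsupp.le_weight a (ha i).ne' u
      omega
    · ext i; simp
  calc Module.finrank ℂ (weightedHomogeneousSubmodule ℂ a d)
      ≤ Module.finrank ℂ (Submodule.span ℂ (B : Set (MvPolynomial (Fin m) ℂ))) :=
        Submodule.finrank_mono hle
    _ ≤ B.card := finrank_span_finset_le_card B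
    _ ≤ E.card := Finset.card_image_le
    _ ≤ (Fintype.piFinset fun _ : Fin m => Finset.range (d + 1)).card := Finset.card_image_le
    _ = (d + 1) ^ m := by simp

/-- The weighted homogeneous elements of degree `d` of an ideal. -/
def gradedPart (a : Fin m → ℕ) (J : Ideal (MvPolynomial (Fin m) ℂ)) (d : ℕ) :
    Submodule ℂ (MvPolynomial (Fin m) ℂ) :=
  J.restrictScalars ℂ ⊓ weightedHomogeneousSubmodule ℂ a d

theorem mem_gradedPart {f : MvPolynomial (Fin m) ℂ} {d : ℕ} :
    f ∈ gradedPart a J d ↔ f ∈ J ∧ IsWeightedHomogeneous a f d := Iff.rfl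

/-- The part of degree `d` of the quotient by an ideal. -/
def quotientPart (a : Fin m → ℕ) (J : Ideal (MvPolynomial (Fin m) ℂ)) (d : ℕ) :
    Submodule ℂ (MvPolynomial (Fin m) ℂ ⧸ J) :=
  (weightedHomogeneousSubmodule ℂ a d).map (Ideal.Quotient.mkₐ ℂ J).toLinearMap

/-- The Hilbert function of the quotient by an ideal. -/
def hilb (a : Fin m → ℕ) (J : Ideal (MvPolynomial (Fin m) ℂ)) (d : ℕ) : ℕ :=
  Module.finrank ℂ (quotientPart a J d)

theorem finiteDimensional_gradedPart (ha : ∀ i, 0 < a i) (d : ℕ) :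
    FiniteDimensional ℂ (gradedPart a J d) :=
  have := finiteDimensional_weightedHomogeneousSubmodule ha d
  Submodule.finiteDimensional_of_le inf_le_right

theorem finiteDimensional_quotientPart (ha : ∀ i, 0 < a i) (d : ℕ) :
    FiniteDimensional ℂ (quotientPart a J d) :=
  have := finiteDimensional_weightedHomogeneousSubmodule ha d
  inferInstanceAs (FiniteDimensional ℂ
    ((weightedHomogeneousSubmodule ℂ a d).map (Ideal.Quotient.mkₐ ℂ J).toLinearMap))

theorem hilb_add_finrank_gradedPart (ha : ∀ i, 0 < a i) (d : ℕ) :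
    hilb a J d + Module.finrank ℂ (gradedPart a J d) =
      Module.finrank ℂ (weightedHomogeneousSubmodule ℂ a d) := by
  have := finiteDimensional_weightedHomogeneousSubmodule ha d
  let L : weightedHomogeneousSubmodule ℂ a d →ₗ[ℂ] MvPolynomial (Fin m) ℂ ⧸ J :=
    (Ideal.Quotient.mkₐ ℂ J).toLinearMap ∘ₗ (weightedHomogeneousSubmodule ℂ a d).subtype
  have h1 : LinearMap.range L = quotientPart a J d := by
    rw [LinearMap.range_comp, Submodule.range_subtype]; rfl
  have h2 : (LinearMap.ker L).map (weightedHomogeneousSubmodule ℂ a d).subtype =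
      gradedPart a J d := by
    ext f
    simp only [Submodule.mem_map, LinearMap.mem_ker, mem_gradedPart]
    constructor
    · rintro ⟨x, hx, rfl⟩
      exact ⟨Ideal.Quotient.eq_zero_iff_mem.mp hx, x.2⟩
    · rintro ⟨h, h'⟩
      exact ⟨⟨f, h'⟩, Ideal.Quotient.eq_zero_iff_mem.mpr h, rfl⟩
  have h3 : Module.finrank ℂ (gradedPart a J d) = Module.finrank ℂ (LinearMap.ker L) := by
    rw [← h2]
    exact (Submodule.equivMapOfInjective _ (Submodule.injective_subtype _) _).finrank_eq.symm
  rw [h3, hilb, ← h1]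
  exact LinearMap.finrank_range_add_finrank_ker L

theorem hilb_le (ha : ∀ i, 0 < a i) (d : ℕ) : hilb a J d ≤ (d + 1) ^ m := by
  have h1 := hilb_add_finrank_gradedPart (J := J) ha d
  have h2 := finrank_weightedHomogeneousSubmodule_le ha d
  omega

theorem hilb_top (d : ℕ) : hilb a (⊤ : Ideal (MvPolynomial (Fin m) ℂ)) d = 0 := by
  have : Subsingleton (MvPolynomial (Fin m) ℂ ⧸ (⊤ : Ideal (MvPolynomial (Fin m) ℂ))) :=
    Ideal.Quotient.subsingleton_iff.mpr rfl
  exact Module.finrank_zero_of_subsingleton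

theorem gradedPart_sup_span_add {g : MvPolynomial (Fin m) ℂ} {e : ℕ} (hJ : IsWHom a J)
    (hg : IsWeightedHomogeneous a g e) (d : ℕ) :
    gradedPart a (J ⊔ Ideal.span {g}) (e + d) = gradedPart a J (e + d) ⊔
      (weightedHomogeneousSubmodule ℂ a d).map (LinearMap.mulLeft ℂ g) := by
  apply le_antisymm
  · rintro f ⟨hf, hfd⟩
    obtain ⟨u, hu, v, hv, rfl⟩ := Submodule.mem_sup.mp hf
    obtain ⟨w, rfl⟩ := Ideal.mem_span_singleton.mp hv
    rw [← (show weightedHomogeneousComponent a (e + d) (u + g * w) = u + g * w from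
      weightedHomogeneousComponent_eq_self hfd), map_add, weightedHomogeneousComponent_mul hg]
    exact Submodule.add_mem_sup ⟨hJ u hu _, weightedHomogeneousComponent_mem _ _ _⟩
      ⟨_, weightedHomogeneousComponent_mem _ _ _, rfl⟩
  · refine sup_le (inf_le_inf_right _ fun x hx => Ideal.mem_sup_left hx) ?_
    rintro _ ⟨w, hw, rfl⟩
    exact ⟨Ideal.mem_sup_right (Ideal.mem_span_singleton.mpr ⟨w, rfl⟩), hg.mul hw⟩

theorem gradedPart_sup_span_of_lt {g : MvPolynomial (Fin m) ℂ} {e : ℕ} (hJ : IsWHom a J)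
    (hg : IsWeightedHomogeneous a g e) {d : ℕ} (hd : d < e) :
    gradedPart a (J ⊔ Ideal.span {g}) d = gradedPart a J d := by
  apply le_antisymm
  · rintro f ⟨hf, hfd⟩
    obtain ⟨u, hu, v, hv, rfl⟩ := Submodule.mem_sup.mp hf
    obtain ⟨w, rfl⟩ := Ideal.mem_span_singleton.mp hv
    rw [← (show weightedHomogeneousComponent a d (u + g * w) = u + g * w from
      weightedHomogeneousComponent_eq_self hfd), map_add,
      weightedHomogeneousComponent_mul_of_lt hg w hd, add_zero]
    exact ⟨hJ u hu _, weightedHomogeneousComponent_mem _ _ _⟩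
  · exact inf_le_inf_right _ fun x hx => Ideal.mem_sup_left hx

theorem gradedPart_inf_map_mulLeft {g : MvPolynomial (Fin m) ℂ} {e : ℕ}
    (hg : IsWeightedHomogeneous a g e) (d : ℕ) :
    gradedPart a J (e + d) ⊓ (weightedHomogeneousSubmodule ℂ a d).map (LinearMap.mulLeft ℂ g) =
      (gradedPart a (colon J g) d).map (LinearMap.mulLeft ℂ g) := by
  apply le_antisymm
  · rintro _ ⟨⟨hf, -⟩, w, hw, rfl⟩
    exact ⟨w, ⟨hf, hw⟩, rfl⟩
  · rintro _ ⟨w, ⟨hw, hwd⟩, rfl⟩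
    exact ⟨⟨hw, hg.mul hwd⟩, w, hwd, rfl⟩

/-- This is the exact sequence for multiplication by `g`, read on ideals: `(J + (g))_{e+d} = J_{e+d}
+ g R_d`, with intersection `g (J : g)_d`. -/
theorem hilb_eq_add (ha : ∀ i, 0 < a i) {g : MvPolynomial (Fin m) ℂ} {e : ℕ} (hJ : IsWHom a J)
    (hg : IsWeightedHomogeneous a g e) (hgJ : g ∉ J) (d : ℕ) :
    hilb a J (e + d) = hilb a (colon J g) d + hilb a (J ⊔ Ideal.span {g}) (e + d) := by
  have := finiteDimensional_weightedHomogeneousSubmodule ha d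
  have := finiteDimensional_gradedPart (J := J) ha (e + d)
  have hinj : Function.Injective (LinearMap.mulLeft ℂ g) := by
    intro x y hxy
    refine mul_left_cancel₀ ?_ (show g * x = g * y from hxy)
    rintro rfl
    exact hgJ J.zero_mem
  have hfin : ∀ S : Submodule ℂ (MvPolynomial (Fin m) ℂ),
      Module.finrank ℂ (S.map (LinearMap.mulLeft ℂ g)) = Module.finrank ℂ S :=
    fun S => (Submodule.equivMapOfInjective _ hinj S).finrank_eq.symm
  have h1 : Module.finrank ℂ (gradedPart a (J ⊔ Ideal.span {g}) (e + d)) +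
      Module.finrank ℂ (gradedPart a (colon J g) d) = Module.finrank ℂ (gradedPart a J (e + d)) +
      Module.finrank ℂ (weightedHomogeneousSubmodule ℂ a d) := by
    rw [← hfin (gradedPart a (colon J g) d), ← hfin (weightedHomogeneousSubmodule ℂ a d),
      gradedPart_sup_span_add hJ hg, ← gradedPart_inf_map_mulLeft hg]
    exact Submodule.finrank_sup_add_finrank_inf_eq _ _
  have h2 := hilb_add_finrank_gradedPart (J := J) ha (e + d)
  have h3 := hilb_add_finrank_gradedPart (J := colon J g) ha d
  have h4 := hilb_add_finrank_gradedPart (J := J ⊔ Ideal.span {g}) ha (e + d)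
  omega

theorem hilb_eq_of_lt (ha : ∀ i, 0 < a i) {g : MvPolynomial (Fin m) ℂ} {e : ℕ} (hJ : IsWHom a J)
    (hg : IsWeightedHomogeneous a g e) {d : ℕ} (hd : d < e) :
    hilb a J d = hilb a (J ⊔ Ideal.span {g}) d := by
  have h2 := hilb_add_finrank_gradedPart (J := J) ha d
  have h4 := hilb_add_finrank_gradedPart (J := J ⊔ Ideal.span {g}) ha d
  rw [gradedPart_sup_span_of_lt hJ hg hd] at h4
  omega

/-- The Hilbert series of the quotient by an ideal, as a function of a real variable. -/
def hilbSeries (a : Fin m → ℕ) (J : Ideal (MvPolynomial (Fin m) ℂ)) (t : ℝ) : ℝ :=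
  ∑' d, (hilb a J d : ℝ) * t ^ d

theorem summable_hilb (ha : ∀ i, 0 < a i) (J : Ideal (MvPolynomial (Fin m) ℂ)) {t : ℝ}
    (h0 : 0 ≤ t) (h1 : t < 1) : Summable fun d => (hilb a J d : ℝ) * t ^ d := by
  have hs1 : Summable fun d : ℕ => (d : ℝ) ^ m * t ^ d :=
    summable_pow_mul_geometric_of_norm_lt_one m (by rwa [Real.norm_of_nonneg h0])
  have hs2 : Summable fun d : ℕ => t ^ d := summable_geometric_of_lt_one h0 h1
  have hs : Summable fun d : ℕ => (2 : ℝ) ^ m * ((d : ℝ) ^ m * t ^ d) + t ^ d :=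
    (hs1.mul_left _).add hs2
  refine Summable.of_nonneg_of_le (fun d => by positivity) (fun d => ?_) hs
  have h2 : (hilb a J d : ℝ) ≤ ((d : ℝ) + 1) ^ m := by exact_mod_cast hilb_le ha d
  have h3 : ((d : ℝ) + 1) ^ m ≤ 2 ^ m * (d : ℝ) ^ m + 1 := by
    rcases Nat.eq_zero_or_pos d with rfl | hd
    · simp only [Nat.cast_zero, zero_add, one_pow]
      exact le_add_of_nonneg_left (by positivity)
    · have h4 : (d : ℝ) + 1 ≤ 2 * d := by
        have : (1 : ℝ) ≤ d := by exact_mod_cast hd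
        linarith
      calc ((d : ℝ) + 1) ^ m ≤ (2 * d) ^ m := by gcongr
        _ = 2 ^ m * (d : ℝ) ^ m := mul_pow _ _ _
        _ ≤ _ := by linarith
  calc (hilb a J d : ℝ) * t ^ d ≤ (2 ^ m * (d : ℝ) ^ m + 1) * t ^ d := by
        gcongr
        exact h2.trans h3
    _ = _ := by ring

theorem hilbSeries_nonneg (a : Fin m → ℕ) (J : Ideal (MvPolynomial (Fin m) ℂ)) {t : ℝ}
    (h0 : 0 ≤ t) : 0 ≤ hilbSeries a J t :=
  tsum_nonneg fun d => by positivity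

theorem sum_hilb_le_hilbSeries (ha : ∀ i, 0 < a i) (J : Ideal (MvPolynomial (Fin m) ℂ)) {t : ℝ}
    (h0 : 0 ≤ t) (h1 : t < 1) (s : Finset ℕ) :
    ∑ d ∈ s, (hilb a J d : ℝ) * t ^ d ≤ hilbSeries a J t :=
  (summable_hilb ha J h0 h1).sum_le_tsum s fun d _ => by positivity

theorem hilbSeries_top (t : ℝ) : hilbSeries a (⊤ : Ideal (MvPolynomial (Fin m) ℂ)) t = 0 := by
  simp [hilbSeries, hilb_top]

theorem hilbSeries_eq_add (ha : ∀ i, 0 < a i) {g : MvPolynomial (Fin m) ℂ} {e : ℕ}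
    (hJ : IsWHom a J) (hg : IsWeightedHomogeneous a g e) (hgJ : g ∉ J) {t : ℝ}
    (h0 : 0 ≤ t) (h1 : t < 1) :
    hilbSeries a J t =
      t ^ e * hilbSeries a (colon J g) t + hilbSeries a (J ⊔ Ideal.span {g}) t := by
  have hJs := summable_hilb ha J h0 h1
  have hKs := summable_hilb ha (J ⊔ Ideal.span {g}) h0 h1
  have hCs := summable_hilb ha (colon J g) h0 h1
  unfold hilbSeries
  rw [← hJs.sum_add_tsum_nat_add e, ← hKs.sum_add_tsum_nat_add e, ← tsum_mul_left]
  have h2 : ∑ d ∈ Finset.range e, (hilb a J d : ℝ) * t ^ d =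
      ∑ d ∈ Finset.range e, (hilb a (J ⊔ Ideal.span {g}) d : ℝ) * t ^ d := by
    refine Finset.sum_congr rfl fun d hd => ?_
    rw [hilb_eq_of_lt ha hJ hg (Finset.mem_range.mp hd)]
  have h3 : ∑' d, (hilb a J (d + e) : ℝ) * t ^ (d + e) =
      ∑' d, t ^ e * ((hilb a (colon J g) d : ℝ) * t ^ d) +
        ∑' d, (hilb a (J ⊔ Ideal.span {g}) (d + e) : ℝ) * t ^ (d + e) := by
    rw [← (hCs.mul_left _).tsum_add ((summable_nat_add_iff e).mpr hKs)]
    refine tsum_congr fun d => ?_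
    rw [add_comm d e, hilb_eq_add ha hJ hg hgJ, pow_add]
    push_cast
    ring
  rw [h2, h3]
  ring

theorem colon_eq_of_isPrime {g : MvPolynomial (Fin m) ℂ} (hW : W.IsPrime) (hg : g ∉ W) :
    colon W g = W :=
  le_antisymm (fun _ hf => (hW.mem_or_mem hf).resolve_left hg) (le_colon g)

/-- Modulo a prime not containing it, `X i` is a nonzerodivisor: the colon ideal is the prime
itself. -/
theorem hilbSeries_prime_sup_X (ha : ∀ i, 0 < a i) (hW : W.IsPrime) (hWh : IsWHom a W) {i : Fin m}
    (hi : X i ∉ W) {t : ℝ} (h0 : 0 ≤ t) (h1 : t < 1) :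
    hilbSeries a (W ⊔ Ideal.span {X i}) t = (1 - t ^ a i) * hilbSeries a W t := by
  have h := hilbSeries_eq_add ha hWh (isWeightedHomogeneous_X ℂ a i) hi h0 h1
  rw [colon_eq_of_isPrime hW hi] at h
  linarith

theorem hilb_irrelevant (a : Fin m → ℕ) (d : ℕ) :
    hilb a (irrelevant m) d = if d = 0 then 1 else 0 := by
  split_ifs with h
  · subst h
    have h1 : quotientPart a (irrelevant m) 0 = Submodule.span ℂ {1} := by
      apply le_antisymm
      · rintro _ ⟨f, hf, rfl⟩
        have h2 : f - C (coeff 0 f) ∈ irrelevant m := by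
          rw [irrelevant, RingHom.mem_ker, map_sub, constantCoeff_C, constantCoeff_eq, sub_self]
        rw [Submodule.mem_span_singleton]
        refine ⟨coeff 0 f, ?_⟩
        have h3 := (Ideal.Quotient.mk_eq_mk_iff_sub_mem _ _).mpr h2
        change _ = Ideal.Quotient.mk _ f
        rw [h3]
        change coeff 0 f • (Ideal.Quotient.mkₐ ℂ (irrelevant m)) 1 =
          (Ideal.Quotient.mkₐ ℂ (irrelevant m)) (C (coeff 0 f))
        rw [← map_smul, smul_eq_C_mul, mul_one]
      · rw [Submodule.span_singleton_le_iff_mem]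
        exact ⟨1, isWeightedHomogeneous_one ℂ a, rfl⟩
    rw [hilb, h1, finrank_span_singleton]
    have := Ideal.Quotient.nontrivial_iff.mpr
      (inferInstance : (irrelevant m).IsPrime).ne_top
    exact one_ne_zero
  · have h1 : quotientPart a (irrelevant m) d = ⊥ := by
      rw [eq_bot_iff]
      rintro _ ⟨f, hf, rfl⟩
      refine Ideal.Quotient.eq_zero_iff_mem.mpr ?_
      rw [irrelevant, RingHom.mem_ker, constantCoeff_eq]
      exact IsWeightedHomogeneous.coeff_eq_zero hf 0 (by rw [map_zero]; exact Ne.symm h)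
    rw [hilb, h1, finrank_bot]

theorem hilbSeries_irrelevant (a : Fin m → ℕ) (t : ℝ) :
    hilbSeries a (irrelevant m) t = 1 := by
  unfold hilbSeries
  rw [tsum_eq_single 0 (fun d hd => by rw [hilb_irrelevant a, if_neg hd]; simp),
    hilb_irrelevant a]
  simp

end Hilbert

/-! ### Lengths of local rings and fundamental cycles -/

/-- Multiplication by `g` gives the exact sequence `0 → A/K → A/I → A/(I + (g)) → 0`, where `K = (I
: g)`. -/
theorem length_quotient_eq_add {A : Type*} [CommRing A] {I K : Ideal A} {g : A}
    (hK : ∀ x, x ∈ K ↔ g * x ∈ I) :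
    Module.length A (A ⧸ I) =
      Module.length A (A ⧸ K) + Module.length A (A ⧸ (I ⊔ Ideal.span {g})) := by
  have hle : K ≤ Submodule.comap (LinearMap.mulLeft A g) I := fun x hx => (hK x).mp hx
  refine Module.length_eq_add_of_exact
    (Submodule.mapQ K I (LinearMap.mulLeft A g) hle)
    (Submodule.factor (le_sup_left : I ≤ I ⊔ Ideal.span {g})) ?_
    (Submodule.factor_surjective _) ?_
  · rw [← LinearMap.ker_eq_bot, LinearMap.ker_eq_bot']
    intro x hx
    obtain ⟨x, rfl⟩ := Submodule.Quotient.mk_surjective _ x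
    rw [Submodule.mapQ_apply, Submodule.Quotient.mk_eq_zero] at hx
    exact (Submodule.Quotient.mk_eq_zero _).mpr ((hK x).mpr hx)
  · intro x
    obtain ⟨x, rfl⟩ := Submodule.Quotient.mk_surjective _ x
    change (Submodule.Quotient.mk x : A ⧸ (I ⊔ Ideal.span {g})) = 0 ↔ _
    rw [Submodule.Quotient.mk_eq_zero]
    constructor
    · intro hx
      obtain ⟨u, hu, v, hv, rfl⟩ := Submodule.mem_sup.mp hx
      obtain ⟨w, rfl⟩ := Ideal.mem_span_singleton.mp hv
      refine ⟨Submodule.Quotient.mk w, ?_⟩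
      rw [Submodule.mapQ_apply, Submodule.Quotient.eq]
      change g * w - (u + g * w) ∈ I
      rw [sub_add_cancel_right]
      exact I.neg_mem hu
    · rintro ⟨y, hy⟩
      obtain ⟨y, rfl⟩ := Submodule.Quotient.mk_surjective _ y
      rw [Submodule.mapQ_apply, Submodule.Quotient.eq] at hy
      have h1 : x = -(g * y - x) + g * y := by ring
      rw [h1]
      exact Ideal.add_mem _ (Ideal.mem_sup_left (I.neg_mem hy))
        (Ideal.mem_sup_right (Ideal.mem_span_singleton.mpr ⟨y, rfl⟩))

section Cycle

variable {m : ℕ} {a : Fin m → ℕ} {J : Ideal (MvPolynomial (Fin m) ℂ)}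
  {W : PrimeSpectrum (MvPolynomial (Fin m) ℂ)}

/-- The length of the local ring of `V(J)` at `W`, possibly infinite. -/
def elengthAt (J : Ideal (MvPolynomial (Fin m) ℂ))
    (W : PrimeSpectrum (MvPolynomial (Fin m) ℂ)) : ℕ∞ :=
  Module.length (Localization.AtPrime W.asIdeal)
    (Localization.AtPrime W.asIdeal ⧸
      J.map (algebraMap (MvPolynomial (Fin m) ℂ) (Localization.AtPrime W.asIdeal)))

theorem elengthAt_eq_zero (h : ¬ J ≤ W.asIdeal) : elengthAt J W = 0 := by
  obtain ⟨f, hfJ, hfW⟩ := SetLike.not_le_iff_exists.mp h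
  have h1 : J.map (algebraMap (MvPolynomial (Fin m) ℂ) (Localization.AtPrime W.asIdeal)) = ⊤ :=
    Ideal.eq_top_of_isUnit_mem _ (Ideal.mem_map_of_mem _ hfJ)
      (IsLocalization.map_units (M := W.asIdeal.primeCompl) _ ⟨f, hfW⟩)
  have : Subsingleton (Localization.AtPrime W.asIdeal ⧸
      J.map (algebraMap (MvPolynomial (Fin m) ℂ) (Localization.AtPrime W.asIdeal))) :=
    Ideal.Quotient.subsingleton_iff.mpr h1
  exact Module.length_eq_zero

theorem elengthAt_self : elengthAt W.asIdeal W = 1 := by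
  unfold elengthAt
  rw [Localization.AtPrime.map_eq_maximalIdeal, Module.length_eq_one_iff,
    isSimpleModule_iff_isCoatom, ← Ideal.isMaximal_def]
  infer_instance

theorem elengthAt_add (g : MvPolynomial (Fin m) ℂ) :
    elengthAt J W = elengthAt (colon J g) W + elengthAt (J ⊔ Ideal.span {g}) W := by
  unfold elengthAt
  rw [Ideal.map_sup, Ideal.map_span, Set.image_singleton]
  apply length_quotient_eq_add
  intro x
  obtain ⟨r, s, rfl⟩ := IsLocalization.exists_mk'_eq W.asIdeal.primeCompl x
  rw [← IsLocalization.mk'_one (M := W.asIdeal.primeCompl) (Localization.AtPrime W.asIdeal) g,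
    ← IsLocalization.mk'_mul, one_mul,
    IsLocalization.mk'_mem_map_algebraMap_iff, IsLocalization.mk'_mem_map_algebraMap_iff]
  simp only [mem_colon, mul_left_comm]

theorem mem_minimalPrimes_or_not_le {K : Ideal (MvPolynomial (Fin m) ℂ)} (h : J ≤ K)
    (hW : W.asIdeal ∈ J.minimalPrimes) : W.asIdeal ∈ K.minimalPrimes ∨ ¬ K ≤ W.asIdeal := by
  by_cases hK : K ≤ W.asIdeal
  · exact Or.inl ⟨⟨W.2, hK⟩, fun Q hQ => hW.2 ⟨hQ.1, h.trans hQ.2⟩⟩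
  · exact Or.inr hK

/-- Finiteness permits passing from additivity in `ℕ∞` to additivity of the natural-number
multiplicities in the cycle. -/
theorem elengthAt_ne_top (hJ : IsWHom a J)
    (hW : W.asIdeal ∈ J.minimalPrimes ∨ ¬ J ≤ W.asIdeal) : elengthAt J W ≠ ⊤ := by
  rcases hW with hW | hW
  swap
  · rw [elengthAt_eq_zero hW]; exact ENat.zero_ne_top
  revert hW
  refine homogeneous_induction (a := a)
    (P := fun J => W.asIdeal ∈ J.minimalPrimes → elengthAt J W ≠ ⊤) ?_ ?_ ?_ J hJ
  · intro hW
    exact absurd (top_le_iff.mp hW.1.2) W.2.ne_top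
  · intro Q hQ _ hW
    have h1 : Q = W.asIdeal := le_antisymm hW.1.2 (hW.2 ⟨hQ, le_rfl⟩ hW.1.2)
    rw [h1, elengthAt_self]
    exact ENat.one_ne_top
  · intro J g e _ _ _ h1 h2 hW
    rw [elengthAt_add g]
    refine WithTop.add_ne_top.mpr ⟨?_, ?_⟩
    · rcases mem_minimalPrimes_or_not_le (le_colon g) hW with h | h
      · exact h1 h
      · rw [elengthAt_eq_zero h]; exact ENat.zero_ne_top
    · rcases mem_minimalPrimes_or_not_le (le_sup_left : J ≤ J ⊔ Ideal.span {g}) hW with h | h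
      · exact h2 h
      · rw [elengthAt_eq_zero h]; exact ENat.zero_ne_top

theorem fundamentalCycle_eq_lengthAt {K : Ideal (MvPolynomial (Fin m) ℂ)} {k : ℕ} (h : J ≤ K)
    (hW : W.asIdeal ∈ J.minimalPrimes) (hd : affineDim W.asIdeal = k) :
    fundamentalCycle k K W = (elengthAt K W).toNat := by
  unfold fundamentalCycle
  rcases mem_minimalPrimes_or_not_le h hW with h1 | h1
  · rw [if_pos ⟨h1, hd⟩]; rfl
  · rw [elengthAt_eq_zero h1, if_neg fun h2 => h1 h2.1.1.2]; rfl

theorem fundamentalCycle_add_of_mem (hJ : IsWHom a J) {g : MvPolynomial (Fin m) ℂ} {e k : ℕ}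
    (hg : IsWeightedHomogeneous a g e) (hW : W.asIdeal ∈ J.minimalPrimes)
    (hd : affineDim W.asIdeal = k) :
    fundamentalCycle k J W =
      fundamentalCycle k (colon J g) W + fundamentalCycle k (J ⊔ Ideal.span {g}) W := by
  rw [fundamentalCycle_eq_lengthAt le_rfl hW hd, fundamentalCycle_eq_lengthAt (le_colon g) hW hd,
    fundamentalCycle_eq_lengthAt (le_sup_left : J ≤ J ⊔ Ideal.span {g}) hW hd, elengthAt_add g]
  exact ENat.toNat_add
    (elengthAt_ne_top (hJ.colon hg) (mem_minimalPrimes_or_not_le (le_colon g) hW))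
    (elengthAt_ne_top (hJ.sup_span hg) (mem_minimalPrimes_or_not_le le_sup_left hW))

/-- Only an inequality without a dimension bound on `J`: a prime of dimension `k` can be minimal
over `(J : g)` or `J + (g)` while embedded in a larger component of `V(J)`. -/
theorem fundamentalCycle_le_add (hJ : IsWHom a J) {g : MvPolynomial (Fin m) ℂ} {e : ℕ}
    (hg : IsWeightedHomogeneous a g e) (k : ℕ) (W : PrimeSpectrum (MvPolynomial (Fin m) ℂ)) :
    fundamentalCycle k J W ≤
      fundamentalCycle k (colon J g) W + fundamentalCycle k (J ⊔ Ideal.span {g}) W := by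
  by_cases h : W.asIdeal ∈ J.minimalPrimes ∧ affineDim W.asIdeal = k
  · exact (fundamentalCycle_add_of_mem hJ hg h.1 h.2).le
  · rw [fundamentalCycle, if_neg h]
    exact Nat.zero_le _

/-- When `dim V(J) ≤ k`, every prime of dimension `k` over `J`, or over a larger ideal, is already
minimal over `J`, so no component is lost or created. -/
theorem fundamentalCycle_eq_add (hJ : IsWHom a J) {g : MvPolynomial (Fin m) ℂ} {e k : ℕ}
    (hg : IsWeightedHomogeneous a g e) (hd : affineDim J ≤ k)
    (W : PrimeSpectrum (MvPolynomial (Fin m) ℂ)) :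
    fundamentalCycle k J W =
      fundamentalCycle k (colon J g) W + fundamentalCycle k (J ⊔ Ideal.span {g}) W := by
  by_cases h : W.asIdeal ∈ J.minimalPrimes ∧ affineDim W.asIdeal = k
  · exact fundamentalCycle_add_of_mem hJ hg h.1 h.2
  · have h1 : ∀ K, J ≤ K → fundamentalCycle k K W = 0 := by
      intro K hK
      refine if_neg fun h2 => h ⟨mem_minimalPrimes_of_affineDim_le W.2 (hK.trans h2.1.1.2) ?_, h2.2⟩
      rw [h2.2]; exact hd
    rw [h1 J le_rfl, h1 _ (le_colon g), h1 _ le_sup_left]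

open Classical in
theorem fundamentalCycle_prime {Q : Ideal (MvPolynomial (Fin m) ℂ)} (hQ : Q.IsPrime) (k : ℕ)
    (W : PrimeSpectrum (MvPolynomial (Fin m) ℂ)) :
    fundamentalCycle k Q W = if W = ⟨Q, hQ⟩ ∧ affineDim Q = k then 1 else 0 := by
  unfold fundamentalCycle
  by_cases hW : W = ⟨Q, hQ⟩
  · subst hW
    have h1 : Q ∈ Q.minimalPrimes := by
      rw [Ideal.minimalPrimes_eq_subsingleton_self]; rfl
    have h2 : lengthAt Q ⟨Q, hQ⟩ = 1 := by
      have := elengthAt_self (W := ⟨Q, hQ⟩)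
      change (elengthAt Q ⟨Q, hQ⟩).toNat = 1
      rw [this]; rfl
    simp [h1, h2]
  · rw [if_neg, if_neg fun h => hW h.1]
    rintro ⟨h1, -⟩
    rw [Ideal.minimalPrimes_eq_subsingleton_self] at h1
    exact hW (PrimeSpectrum.ext h1)

theorem finite_support_fundamentalCycle (k : ℕ) (J : Ideal (MvPolynomial (Fin m) ℂ)) :
    (Function.support (fundamentalCycle k J)).Finite := by
  refine ((Ideal.finite_minimalPrimes_of_isNoetherianRing _ J).preimage
    (f := PrimeSpectrum.asIdeal) fun _ _ _ _ h => PrimeSpectrum.ext h).subset fun W hW => ?_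
  by_contra h
  exact hW (if_neg fun h' => h h'.1)

theorem isWHom_of_fundamentalCycle_ne_zero {k : ℕ} (hJ : IsWHom a J)
    (hW : fundamentalCycle k J W ≠ 0) : IsWHom a W.asIdeal ∧ affineDim W.asIdeal = k := by
  by_cases h : W.asIdeal ∈ J.minimalPrimes ∧ affineDim W.asIdeal = k
  · exact ⟨isWHom_of_minimalPrimes hJ h.1, h.2⟩
  · exact absurd (if_neg h) hW

end Cycle

/-! ### Leading coefficients of Hilbert series -/

section Limit

open Filter Topology

variable {m : ℕ} {a : Fin m → ℕ} {J : Ideal (MvPolynomial (Fin m) ℂ)}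

theorem eventually_mem_Ioo : ∀ᶠ t : ℝ in 𝓝[<] 1, 0 < t ∧ t < 1 :=
  Ioo_mem_nhdsLT one_pos

theorem tendsto_pow_nhdsLT_one (e : ℕ) : Tendsto (fun t : ℝ => t ^ e) (𝓝[<] 1) (𝓝 1) := by
  have h : Tendsto (fun t : ℝ => t ^ e) (𝓝 1) (𝓝 (1 ^ e)) := (continuous_pow e).tendsto 1
  rw [one_pow] at h
  exact h.mono_left nhdsWithin_le_nhds

theorem tendsto_one_sub_pow {e : ℕ} (he : e ≠ 0) :
    Tendsto (fun t : ℝ => (1 - t) ^ e) (𝓝[<] 1) (𝓝 0) := by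
  have h : Tendsto (fun t : ℝ => (1 - t) ^ e) (𝓝 1) (𝓝 ((1 - 1) ^ e)) :=
    (by fun_prop : Continuous fun t : ℝ => (1 - t) ^ e).tendsto 1
  rw [sub_self, zero_pow he] at h
  exact h.mono_left nhdsWithin_le_nhds

theorem tendsto_one_sub_pow_div (e : ℕ) :
    Tendsto (fun t : ℝ => (1 - t ^ e) / (1 - t)) (𝓝[<] 1) (𝓝 e) := by
  have h : Tendsto (fun t : ℝ => ∑ i ∈ Finset.range e, t ^ i) (𝓝[<] 1)
      (𝓝 (∑ i ∈ Finset.range e, 1)) := tendsto_finsetSum _ fun i _ => tendsto_pow_nhdsLT_one i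
  simp only [Finset.sum_const, Finset.card_range, nsmul_eq_mul, mul_one] at h
  refine h.congr' ?_
  filter_upwards [eventually_mem_Ioo] with t ht
  rw [geom_sum_eq ht.2.ne, ← neg_div_neg_eq, neg_sub, neg_sub]

theorem tendsto_one_sub_div {e : ℕ} (he : 0 < e) :
    Tendsto (fun t : ℝ => (1 - t) / (1 - t ^ e)) (𝓝[<] 1) (𝓝 (1 / e)) := by
  have h := (tendsto_one_sub_pow_div e).inv₀ (by positivity)
  simpa only [inv_div, one_div] using h

theorem finite_support_cycle_mul (k : ℕ) (J : Ideal (MvPolynomial (Fin m) ℂ))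
    {R : Type*} [Semiring R] (E : PrimeSpectrum (MvPolynomial (Fin m) ℂ) → R) :
    (Function.support fun W => (fundamentalCycle k J W : R) * E W).Finite := by
  refine (finite_support_fundamentalCycle k J).subset fun W hW h => hW ?_
  change (fundamentalCycle k J W : R) * E W = 0
  rw [h, Nat.cast_zero, zero_mul]

theorem finsum_cycle_top (k : ℕ) (E : PrimeSpectrum (MvPolynomial (Fin m) ℂ) → ℝ) :
    ∑ᶠ W, (fundamentalCycle k (⊤ : Ideal (MvPolynomial (Fin m) ℂ)) W : ℝ) * E W = 0 := by
  rw [← finsum_zero]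
  refine finsum_congr fun W => ?_
  rw [fundamentalCycle, if_neg, Nat.cast_zero, zero_mul]
  exact fun h => W.2.ne_top (top_le_iff.mp h.1.1.2)

theorem finsum_cycle_prime {Q : Ideal (MvPolynomial (Fin m) ℂ)} (hQ : Q.IsPrime) {k : ℕ}
    (hk : affineDim Q = k) (E : PrimeSpectrum (MvPolynomial (Fin m) ℂ) → ℝ) :
    ∑ᶠ W, (fundamentalCycle k Q W : ℝ) * E W = E ⟨Q, hQ⟩ := by
  rw [finsum_eq_single _ (⟨Q, hQ⟩ : PrimeSpectrum (MvPolynomial (Fin m) ℂ)),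
    fundamentalCycle_prime hQ, if_pos ⟨rfl, hk⟩, Nat.cast_one, one_mul]
  intro W hW
  rw [fundamentalCycle_prime hQ, if_neg fun h => hW h.1, Nat.cast_zero, zero_mul]

theorem finsum_cycle_prime_of_ne {Q : Ideal (MvPolynomial (Fin m) ℂ)} (hQ : Q.IsPrime) {k : ℕ}
    (hk : affineDim Q ≠ k) (E : PrimeSpectrum (MvPolynomial (Fin m) ℂ) → ℝ) :
    ∑ᶠ W, (fundamentalCycle k Q W : ℝ) * E W = 0 := by
  rw [← finsum_zero]
  refine finsum_congr fun W => ?_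
  rw [fundamentalCycle_prime hQ, if_neg fun h => hk h.2, Nat.cast_zero, zero_mul]

/-- The leading coefficient of the Hilbert series is additive on fundamental cycles. -/
theorem tendsto_hilbSeries_of_primes (ha : ∀ i, 0 < a i) {k : ℕ}
    {E : PrimeSpectrum (MvPolynomial (Fin m) ℂ) → ℝ}
    (hE : ∀ W : PrimeSpectrum (MvPolynomial (Fin m) ℂ), IsWHom a W.asIdeal →
      affineDim W.asIdeal = k →
      Tendsto (fun t => (1 - t) ^ k * hilbSeries a W.asIdeal t) (𝓝[<] 1) (𝓝 (E W)))
    (hlow : ∀ W : PrimeSpectrum (MvPolynomial (Fin m) ℂ), IsWHom a W.asIdeal →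
      affineDim W.asIdeal < k →
      Tendsto (fun t => (1 - t) ^ k * hilbSeries a W.asIdeal t) (𝓝[<] 1) (𝓝 0))
    (hJ : IsWHom a J) (hd : affineDim J ≤ k) :
    Tendsto (fun t => (1 - t) ^ k * hilbSeries a J t) (𝓝[<] 1)
      (𝓝 (∑ᶠ W, (fundamentalCycle k J W : ℝ) * E W)) := by
  revert hd
  refine homogeneous_induction (a := a) (P := fun J => affineDim J ≤ k →
    Tendsto (fun t => (1 - t) ^ k * hilbSeries a J t) (𝓝[<] 1)
      (𝓝 (∑ᶠ W, (fundamentalCycle k J W : ℝ) * E W))) ?_ ?_ ?_ J hJ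
  · intro _
    simp only [finsum_cycle_top, hilbSeries_top, mul_zero]
    exact tendsto_const_nhds
  · intro Q hQ hQh hd
    rcases hd.lt_or_eq with h | h
    · rw [finsum_cycle_prime_of_ne hQ h.ne]
      exact hlow ⟨Q, hQ⟩ hQh h
    · rw [finsum_cycle_prime hQ h]
      exact hE ⟨Q, hQ⟩ hQh h
  · intro J g e hJ hg hgJ h1 h2 hd
    have h3 := ((tendsto_pow_nhdsLT_one e).mul (h1 ((affineDim_anti (le_colon g)).trans hd))).add
      (h2 ((affineDim_anti le_sup_left).trans hd))
    have h4 : ∑ᶠ W, (fundamentalCycle k J W : ℝ) * E W =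
        1 * ∑ᶠ W, (fundamentalCycle k (colon J g) W : ℝ) * E W +
          ∑ᶠ W, (fundamentalCycle k (J ⊔ Ideal.span {g}) W : ℝ) * E W := by
      rw [one_mul, ← finsum_add_distrib (finite_support_cycle_mul k _ E)
        (finite_support_cycle_mul k _ E)]
      refine finsum_congr fun W => ?_
      rw [fundamentalCycle_eq_add hJ hg hd, Nat.cast_add, add_mul]
    rw [h4]
    refine h3.congr' ?_
    filter_upwards [eventually_mem_Ioo] with t ht
    rw [hilbSeries_eq_add ha hJ hg hgJ ht.1.le ht.2]
    ring

/-- A lower bound for the growth of the Hilbert series in terms of the fundamental cycle. -/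
theorem exists_lower_bound_hilbSeries (ha : ∀ i, 0 < a i) {k : ℕ}
    {E : PrimeSpectrum (MvPolynomial (Fin m) ℂ) → ℝ}
    (hE : ∀ W : PrimeSpectrum (MvPolynomial (Fin m) ℂ), IsWHom a W.asIdeal →
      affineDim W.asIdeal = k →
      Tendsto (fun t => (1 - t) ^ k * hilbSeries a W.asIdeal t) (𝓝[<] 1) (𝓝 (E W)))
    (hJ : IsWHom a J) :
    ∃ (L : ℝ → ℝ) (l : ℝ), (∀ t, 0 < t → t < 1 → L t ≤ (1 - t) ^ k * hilbSeries a J t) ∧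
      Tendsto L (𝓝[<] 1) (𝓝 l) ∧ ∑ᶠ W, (fundamentalCycle k J W : ℝ) * E W ≤ l := by
  -- A convergent minorant replaces the limit, since the series itself may diverge when `V(J)` has
  -- components of dimension above `k`. Minorants add up along the dévissage, and `0` serves for
  -- primes of dimension other than `k`.
  refine homogeneous_induction (a := a) (P := fun J => ∃ (L : ℝ → ℝ) (l : ℝ),
    (∀ t, 0 < t → t < 1 → L t ≤ (1 - t) ^ k * hilbSeries a J t) ∧
      Tendsto L (𝓝[<] 1) (𝓝 l) ∧ ∑ᶠ W, (fundamentalCycle k J W : ℝ) * E W ≤ l) ?_ ?_ ?_ J hJ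
  · refine ⟨fun _ => 0, 0, fun t _ _ => ?_, tendsto_const_nhds, (finsum_cycle_top k E).le⟩
    rw [hilbSeries_top, mul_zero]
  · intro Q hQ hQh
    by_cases h : affineDim Q = k
    · exact ⟨_, _, fun t _ _ => le_rfl, hE ⟨Q, hQ⟩ hQh h, (finsum_cycle_prime hQ h E).le⟩
    · refine ⟨fun _ => 0, 0, fun t h0 h1 => ?_, tendsto_const_nhds,
        (finsum_cycle_prime_of_ne hQ h E).le⟩
      exact mul_nonneg (pow_nonneg (sub_nonneg.mpr h1.le) _) (hilbSeries_nonneg a Q h0.le)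
  · rintro J g e hJ hg hgJ ⟨L₁, l₁, hL₁, ht₁, hs₁⟩ ⟨L₂, l₂, hL₂, ht₂, hs₂⟩
    refine ⟨fun t => t ^ e * L₁ t + L₂ t, 1 * l₁ + l₂, fun t h0 h1 => ?_,
      ((tendsto_pow_nhdsLT_one e).mul ht₁).add ht₂, ?_⟩
    · rw [hilbSeries_eq_add ha hJ hg hgJ h0.le h1]
      have h3 := mul_le_mul_of_nonneg_left (hL₁ t h0 h1) (pow_nonneg h0.le e)
      have h4 := hL₂ t h0 h1
      calc _ ≤ t ^ e * ((1 - t) ^ k * hilbSeries a (colon J g) t) +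
          (1 - t) ^ k * hilbSeries a (J ⊔ Ideal.span {g}) t := add_le_add h3 h4
        _ = _ := by ring
    · rw [one_mul]
      refine le_trans ?_ (add_le_add hs₁ hs₂)
      rw [← finsum_add_distrib (finite_support_cycle_mul k _ E) (finite_support_cycle_mul k _ E)]
      -- Nonnegativity of `E` on the support turns the inequality of cycles into one of weighted
      -- sums.
      have hnn : ∀ K, IsWHom a K → ∀ W, fundamentalCycle k K W ≠ 0 → 0 ≤ E W := by
        intro K hK W hW
        obtain ⟨h1, h2⟩ := isWHom_of_fundamentalCycle_ne_zero hK hW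
        refine ge_of_tendsto (hE W h1 h2) ?_
        filter_upwards [eventually_mem_Ioo] with t ht
        exact mul_nonneg (pow_nonneg (sub_nonneg.mpr ht.2.le) _) (hilbSeries_nonneg a _ ht.1.le)
      have hnn' : ∀ K, IsWHom a K → ∀ W, 0 ≤ (fundamentalCycle k K W : ℝ) * E W := by
        intro K hK W
        by_cases hW : fundamentalCycle k K W = 0
        · rw [hW, Nat.cast_zero, zero_mul]
        · exact mul_nonneg (Nat.cast_nonneg _) (hnn K hK W hW)
      refine finsum_le_finsum' (finite_support_cycle_mul k _ E)
        (((finite_support_cycle_mul k (colon J g) E).union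
          (finite_support_cycle_mul k (J ⊔ Ideal.span {g}) E)).subset
            (Function.support_add _ _)) fun W => ?_
      change (fundamentalCycle k J W : ℝ) * E W ≤ (fundamentalCycle k (colon J g) W : ℝ) * E W +
        (fundamentalCycle k (J ⊔ Ideal.span {g}) W : ℝ) * E W
      by_cases hW : fundamentalCycle k J W = 0
      · rw [hW, Nat.cast_zero, zero_mul]
        exact add_nonneg (hnn' _ (hJ.colon hg) W) (hnn' _ (hJ.sup_span hg) W)
      · rw [← add_mul]
        refine mul_le_mul_of_nonneg_right ?_ (hnn J hJ W hW)
        exact_mod_cast fundamentalCycle_le_add hJ hg k W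

theorem finsum_cycle_le_of_tendsto (ha : ∀ i, 0 < a i) {k : ℕ}
    {E : PrimeSpectrum (MvPolynomial (Fin m) ℂ) → ℝ}
    (hE : ∀ W : PrimeSpectrum (MvPolynomial (Fin m) ℂ), IsWHom a W.asIdeal →
      affineDim W.asIdeal = k →
      Tendsto (fun t => (1 - t) ^ k * hilbSeries a W.asIdeal t) (𝓝[<] 1) (𝓝 (E W)))
    (hJ : IsWHom a J) {M : ℝ → ℝ} {μ : ℝ} (hM : Tendsto M (𝓝[<] 1) (𝓝 μ))
    (h : ∀ t, 0 < t → t < 1 → (1 - t) ^ k * hilbSeries a J t ≤ M t) :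
    ∑ᶠ W, (fundamentalCycle k J W : ℝ) * E W ≤ μ := by
  obtain ⟨L, l, hL, hl, hs⟩ := exists_lower_bound_hilbSeries ha hE hJ
  refine hs.trans (le_of_tendsto_of_tendsto hl hM ?_)
  filter_upwards [eventually_mem_Ioo] with t ht
  exact (hL t ht.1 ht.2).trans (h t ht.1 ht.2)

end Limit

/-! ### The degree as leading coefficient of the Hilbert series -/

section Degree

open Filter Topology

variable {m : ℕ} {a : Fin m → ℕ} {W : Ideal (MvPolynomial (Fin m) ℂ)}

theorem exists_X_notMem_of_affineDim_ne_zero (h : affineDim W ≠ 0) :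
    ∃ i, X i ∉ W := by
  by_contra! h'
  exact h (affineDim_eq_zero_of_X_mem h')

theorem affineDim_sup_X_le {i : Fin m} {r : ℕ} (hW : W.IsPrime) (hi : X i ∉ W)
    (hd : affineDim W = r + 1) : affineDim (W ⊔ Ideal.span {X i}) ≤ r := by
  by_cases hT : W ⊔ Ideal.span {X i} = ⊤
  · rw [hT, affineDim_top]; exact Nat.zero_le _
  · have hlt : W < W ⊔ Ideal.span {X i} := by
      refine lt_of_le_of_ne le_sup_left fun he => hi ?_
      rw [he]
      exact Ideal.mem_sup_right (Ideal.mem_span_singleton_self _)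
    have := affineDim_lt hW hlt hT
    omega

/-! ### Cones of dimension zero and one -/

theorem exists_sum_hilb_le (ha : ∀ i, 0 < a i) {J : Ideal (MvPolynomial (Fin m) ℂ)}
    (hJ : IsWHom a J) (hd : affineDim J = 0) :
    ∃ c : ℝ, ∀ N, ∑ d ∈ Finset.range N, (hilb a J d : ℝ) ≤ c := by
  have h := tendsto_hilbSeries_of_primes (k := 0) (E := fun _ => 1) ha ?_ ?_ hJ hd.le
  · refine ⟨_, fun N => le_of_tendsto_of_tendsto (f := fun t : ℝ =>
      ∑ d ∈ Finset.range N, (hilb a J d : ℝ) * t ^ d) (b := 𝓝[<] 1) ?_ h ?_⟩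
    · have h1 : Tendsto (fun t : ℝ => ∑ d ∈ Finset.range N, (hilb a J d : ℝ) * t ^ d) (𝓝[<] 1)
          (𝓝 (∑ d ∈ Finset.range N, (hilb a J d : ℝ) * 1)) :=
        tendsto_finsetSum _ fun d _ => (tendsto_pow_nhdsLT_one d).const_mul _
      simpa only [mul_one] using h1
    · filter_upwards [eventually_mem_Ioo] with t ht
      rw [pow_zero, one_mul]
      exact sum_hilb_le_hilbSeries ha J ht.1.le ht.2 _
  · intro Q hQ hQd
    rw [eq_irrelevant_of_affineDim_eq_zero ha hQ Q.2 hQd]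
    simp only [hilbSeries_irrelevant, pow_zero, mul_one]
    exact tendsto_const_nhds
  · intro Q _ hQd
    exact absurd hQd (Nat.not_lt_zero _)

/-- Cutting by a coordinate `X i ∉ W` leaves dimension zero, where the Hilbert function has bounded
sums. Since `H_W(d) - H_W(d - a_i)` is the Hilbert function of the section, `H_W` is bounded by such
a sum. -/
theorem exists_hilb_le_of_affineDim_eq_one (ha : ∀ i, 0 < a i) (hW : W.IsPrime)
    (hWh : IsWHom a W) (hd : affineDim W = 1) : ∃ c : ℕ, ∀ d, hilb a W d ≤ c := by
  obtain ⟨i, hi⟩ := exists_X_notMem_of_affineDim_ne_zero (W := W) (by omega)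
  have hg := isWeightedHomogeneous_X ℂ a i
  obtain ⟨c, hc⟩ := exists_sum_hilb_le ha (hWh.sup_span hg)
    (Nat.le_zero.mp (affineDim_sup_X_le hW hi hd))
  obtain ⟨c', hc'⟩ := exists_nat_ge c
  refine ⟨c', fun d => ?_⟩
  suffices h : hilb a W d ≤ ∑ j ∈ Finset.range (d + 1), hilb a (W ⊔ Ideal.span {X i}) j by
    have h1 := (hc (d + 1)).trans hc'
    exact h.trans (by exact_mod_cast h1)
  induction d using Nat.strong_induction_on with
  | _ d ih =>
  rw [Finset.sum_range_succ]
  by_cases hlt : d < a i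
  · rw [hilb_eq_of_lt ha hWh hg hlt]
    exact Nat.le_add_left _ _
  · obtain ⟨d', rfl⟩ := Nat.exists_eq_add_of_le (not_lt.mp hlt)
    rw [hilb_eq_add ha hWh hg hi, colon_eq_of_isPrime hW hi]
    have hpos := ha i
    refine Nat.add_le_add_right ((ih d' (by omega)).trans ?_) _
    exact Finset.sum_le_sum_of_subset (Finset.range_mono (by omega))

theorem mem_quotientPart {J : Ideal (MvPolynomial (Fin m) ℂ)} {d : ℕ}
    {x : MvPolynomial (Fin m) ℂ ⧸ J} :
    x ∈ quotientPart a J d ↔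
      ∃ f, IsWeightedHomogeneous a f d ∧ Ideal.Quotient.mk J f = x := Iff.rfl

/-- Dividing a linear relation among the `u^j v^(N-j)` by `v^N` shows that `u / v` is algebraic over
`ℂ`, hence a scalar. -/
theorem exists_smul_eq_of_linearDependent_pow {A : Type*} [CommRing A] [IsDomain A] [Algebra ℂ A]
    {u v : A} (hv : v ≠ 0) {N : ℕ}
    (h : ¬ LinearIndependent ℂ fun j : Fin (N + 1) => u ^ (j : ℕ) * v ^ (N - j)) :
    ∃ c : ℂ, c • v = u := by
  rw [Fintype.not_linearIndependent_iff] at h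
  obtain ⟨c, hsum, j₀, hj₀⟩ := h
  let F := FractionRing A
  have hinj : Function.Injective (algebraMap A F) := IsFractionRing.injective A F
  have hv' : algebraMap A F v ≠ 0 := by rwa [ne_eq, map_eq_zero_iff _ hinj]
  let x : F := algebraMap A F u / algebraMap A F v
  let p : Polynomial ℂ := ∑ j : Fin (N + 1), Polynomial.monomial (j : ℕ) (c j)
  have hp : p ≠ 0 := by
    intro h0
    have h1 : p.coeff j₀ = c j₀ := by
      simp only [p, Polynomial.finsetSum_coeff, Polynomial.coeff_monomial]
      rw [Finset.sum_eq_single j₀ (fun b _ hb => if_neg fun h => hb (Fin.ext h))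
        (fun h => absurd (Finset.mem_univ _) h), if_pos rfl]
    rw [h0, Polynomial.coeff_zero] at h1
    exact hj₀ h1.symm
  have hpx : Polynomial.aeval x p = 0 := by
    have h1 : algebraMap A F v ^ N * Polynomial.aeval x p = 0 := by
      rw [← map_zero (algebraMap A F), ← hsum, map_sum, map_sum, Finset.mul_sum]
      refine Finset.sum_congr rfl fun j _ => ?_
      rw [Polynomial.aeval_monomial, Algebra.smul_def, map_mul, map_mul, map_pow, map_pow,
        ← IsScalarTower.algebraMap_apply, div_pow]
      have h2 : algebraMap A F v ^ N =
          algebraMap A F v ^ (j : ℕ) * algebraMap A F v ^ (N - j) := by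
        rw [← pow_add, Nat.add_sub_cancel' (Nat.lt_succ_iff.mp j.2)]
      have h3 : algebraMap A F v ^ (j : ℕ) *
          (algebraMap A F u ^ (j : ℕ) / algebraMap A F v ^ (j : ℕ)) = algebraMap A F u ^ (j : ℕ) :=
        mul_div_cancel₀ _ (pow_ne_zero _ hv')
      rw [h2]
      linear_combination (algebraMap A F v ^ (N - j) * algebraMap ℂ F (c j)) * h3
    exact (mul_eq_zero.mp h1).resolve_left (pow_ne_zero _ hv')
  have hint : IsIntegral ℂ x := IsAlgebraic.isIntegral ⟨p, hp, hpx⟩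
  obtain ⟨c', hc'⟩ := minpoly.mem_range_of_degree_eq_one ℂ x
    (IsAlgClosed.degree_eq_one_of_irreducible ℂ (minpoly.irreducible hint))
  refine ⟨c', hinj ?_⟩
  have h1 : algebraMap ℂ F c' * algebraMap A F v = algebraMap A F u := by
    have h2 : algebraMap ℂ F c' = x := hc'
    rw [h2, div_mul_cancel₀ _ hv']
  rw [Algebra.smul_def, map_mul, ← IsScalarTower.algebraMap_apply, h1]

/-- For `u`, `v ≠ 0` of degree `d`, the `N + 1` products `u^j v^(N-j)` lie in degree `N d`, of
dimension at most `N`. They are dependent, so `u` is a multiple of `v`. -/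
theorem hilb_le_one_of_affineDim_eq_one (ha : ∀ i, 0 < a i) (hW : W.IsPrime)
    (hWh : IsWHom a W) (hd : affineDim W = 1) (d : ℕ) : hilb a W d ≤ 1 := by
  obtain ⟨N, hN⟩ := exists_hilb_le_of_affineDim_eq_one ha hW hWh hd
  have : IsDomain (MvPolynomial (Fin m) ℂ ⧸ W) := Ideal.Quotient.isDomain W
  by_cases h0 : quotientPart a W d = ⊥
  · rw [hilb, h0, finrank_bot]; exact Nat.zero_le _
  obtain ⟨v, hv, hv0⟩ := Submodule.exists_mem_ne_zero_of_ne_bot h0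
  refine finrank_le_one (⟨v, hv⟩ : quotientPart a W d) fun ⟨u, hu⟩ => ?_
  have hdep : ¬ LinearIndependent ℂ fun j : Fin (N + 1) => u ^ (j : ℕ) * v ^ (N - j) := by
    intro hli
    have hfd := finiteDimensional_quotientPart (J := W) ha (N * d)
    have hmem : ∀ j : Fin (N + 1), u ^ (j : ℕ) * v ^ (N - j) ∈ quotientPart a W (N * d) := by
      obtain ⟨f, hf, rfl⟩ := mem_quotientPart.mp hu
      obtain ⟨g, hg, rfl⟩ := mem_quotientPart.mp hv
      intro j
      refine mem_quotientPart.mpr ⟨f ^ (j : ℕ) * g ^ (N - j), ?_, by simp only [map_mul, map_pow]⟩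
      have h1 := (hf.pow j).mul (hg.pow (N - j))
      rwa [smul_eq_mul, smul_eq_mul, ← add_mul,
        Nat.add_sub_cancel' (Nat.lt_succ_iff.mp j.2)] at h1
    have hli' : LinearIndependent ℂ fun j : Fin (N + 1) =>
        (⟨u ^ (j : ℕ) * v ^ (N - j), hmem j⟩ : quotientPart a W (N * d)) :=
      LinearIndependent.of_comp (quotientPart a W (N * d)).subtype hli
    have h1 := hli'.fintype_card_le_finrank
    rw [Fintype.card_fin] at h1
    have h2 := hN (N * d)
    unfold hilb at h2
    omega
  obtain ⟨c, hc⟩ := exists_smul_eq_of_linearDependent_pow hv0 hdep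
  exact ⟨c, Subtype.ext hc⟩

theorem hilb_eq_zero_of_not_dvd (hW : W.IsPrime) {d : ℕ}
    (hd : ¬ stabilizerOrder a ⟨W, hW⟩ ∣ d) : hilb a W d = 0 := by
  classical
  have h1 : quotientPart a W d = ⊥ := by
    rw [eq_bot_iff]
    rintro _ ⟨f, hf, rfl⟩
    refine Ideal.Quotient.eq_zero_iff_mem.mpr ?_
    rw [f.as_sum]
    refine W.sum_mem fun u hu => ?_
    by_contra hmem
    refine hd ?_
    have hu' : Finsupp.weight a u = d := hf (mem_support_iff.mp hu)
    rw [← hu', Finsupp.weight_apply, Finsupp.sum]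
    refine Finset.dvd_sum fun i hi => Dvd.dvd.mul_left (Finset.gcd_dvd ?_) _
    refine Finset.mem_filter.mpr ⟨Finset.mem_univ _, fun hX => hmem ?_⟩
    have h2 : monomial u (coeff u f) = monomial (u - Finsupp.single i 1) (coeff u f) * X i := by
      rw [X, monomial_mul, mul_one, tsub_add_cancel_of_le]
      rw [Finsupp.single_le_iff]
      exact Nat.one_le_iff_ne_zero.mpr (Finsupp.mem_support_iff.mp hi)
    rw [h2]
    exact W.mul_mem_left _ hX
  rw [hilb, h1, finrank_bot]

/-- The weights of the coordinates not in `W` generate a semigroup containing all large multiples of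
their gcd, and products of such coordinates stay outside the prime. -/
theorem exists_hilb_pos (ha : ∀ i, 0 < a i) (hW : W.IsPrime) :
    ∃ n, ∀ d ≥ n, stabilizerOrder a ⟨W, hW⟩ ∣ d → 0 < hilb a W d := by
  classical
  let s : Set ℕ := {d | ∃ i, X i ∉ W ∧ a i = d}
  obtain ⟨n, hn⟩ := Nat.exists_mem_closure_of_ge s
  refine ⟨n, fun d hd hdvd => ?_⟩
  have hs : Nat.setGcd s ∣ stabilizerOrder a ⟨W, hW⟩ :=
    Finset.dvd_gcd fun i hi => Nat.setGcd_dvd_of_mem ⟨i, (Finset.mem_filter.mp hi).2, rfl⟩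
  have hmem := hn d hd (hs.trans hdvd)
  obtain ⟨f, hf, hfW⟩ : ∃ f, IsWeightedHomogeneous a f d ∧ f ∉ W := by
    clear hd hdvd
    induction hmem using AddSubmonoid.closure_induction with
    | mem x hx =>
      obtain ⟨i, hi, rfl⟩ := hx
      exact ⟨X i, isWeightedHomogeneous_X ℂ a i, hi⟩
    | zero =>
      exact ⟨1, isWeightedHomogeneous_one ℂ a, fun h => hW.ne_top (W.eq_top_of_isUnit_mem h isUnit_one)⟩
    | add x y _ _ hx hy =>
      obtain ⟨f, hf, hfW⟩ := hx
      obtain ⟨g, hg, hgW⟩ := hy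
      exact ⟨f * g, hf.mul hg, fun h => (hW.mem_or_mem h).elim hfW hgW⟩
  have := finiteDimensional_quotientPart (J := W) ha d
  rw [hilb, Module.finrank_pos_iff_exists_ne_zero]
  refine ⟨⟨Ideal.Quotient.mk W f, mem_quotientPart.mpr ⟨f, hf, rfl⟩⟩, fun h => hfW ?_⟩
  exact Ideal.Quotient.eq_zero_iff_mem.mp (congrArg Subtype.val h)

theorem stabilizerOrder_pos (ha : ∀ i, 0 < a i) (hW : W.IsPrime) {i : Fin m} (hi : X i ∉ W) :
    0 < stabilizerOrder a ⟨W, hW⟩ := by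
  classical
  refine Nat.pos_of_ne_zero fun h => (ha i).ne' ?_
  unfold stabilizerOrder at h
  rw [Finset.gcd_eq_zero_iff] at h
  exact h i (Finset.mem_filter.mpr ⟨Finset.mem_univ _, hi⟩)

/-- With `g` the stabilizer order, the Hilbert function is at most `1`, vanishes off multiples of
`g`, and is positive at large ones. So the series lies between `t^(g n) / (1 - t^g)` and `1 / (1 -
t^g)`. -/
theorem tendsto_hilbSeries_of_affineDim_eq_one (ha : ∀ i, 0 < a i) (hW : W.IsPrime)
    (hWh : IsWHom a W) (hd : affineDim W = 1) :
    Tendsto (fun t => (1 - t) * hilbSeries a W t) (𝓝[<] 1)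
      (𝓝 (1 / (stabilizerOrder a ⟨W, hW⟩ : ℝ))) := by
  obtain ⟨i, hi⟩ := exists_X_notMem_of_affineDim_ne_zero (W := W) (by omega)
  have hg := stabilizerOrder_pos ha hW hi
  obtain ⟨n, hn⟩ := exists_hilb_pos ha hW
  have hnd : ∀ d, ¬ stabilizerOrder a ⟨W, hW⟩ ∣ d → hilb a W d = 0 :=
    fun d => hilb_eq_zero_of_not_dvd hW
  generalize stabilizerOrder a ⟨W, hW⟩ = g at hg hn hnd
  have hle := hilb_le_one_of_affineDim_eq_one ha hW hWh hd
  have hinj : Function.Injective fun j : ℕ => g * j := fun x y h => Nat.eq_of_mul_eq_mul_left hg h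
  have hser : ∀ t, hilbSeries a W t = ∑' j, (hilb a W (g * j) : ℝ) * t ^ (g * j) := by
    intro t
    refine (hinj.tsum_eq fun d hd => ?_).symm
    by_contra h
    refine hd ?_
    change (hilb a W d : ℝ) * t ^ d = 0
    rw [hnd d (fun ⟨j, hj⟩ => h ⟨j, hj.symm⟩), Nat.cast_zero, zero_mul]
  have hlim := tendsto_one_sub_div hg
  have hlow := (tendsto_pow_nhdsLT_one (g * n)).mul hlim
  rw [one_mul] at hlow
  refine tendsto_of_tendsto_of_tendsto_of_le_of_le' hlow hlim ?_ ?_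
  · filter_upwards [eventually_mem_Ioo] with t ht
    have htg : t ^ g < 1 := pow_lt_one₀ ht.1.le ht.2 hg.ne'
    have htg0 : 0 ≤ t ^ g := pow_nonneg ht.1.le g
    have hgeo := summable_geometric_of_lt_one htg0 htg
    have hsum : Summable fun j => (hilb a W (g * j) : ℝ) * t ^ (g * j) :=
      (summable_hilb ha W ht.1.le ht.2).comp_injective hinj
    have h1 : t ^ (g * n) / (1 - t ^ g) ≤ hilbSeries a W t := by
      rw [hser, ← hsum.sum_add_tsum_nat_add n]
      have h2 : t ^ (g * n) / (1 - t ^ g) ≤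
          ∑' j, (hilb a W (g * (j + n)) : ℝ) * t ^ (g * (j + n)) := by
        rw [div_eq_mul_inv, ← tsum_geometric_of_lt_one htg0 htg, ← tsum_mul_left]
        refine (hgeo.mul_left _).tsum_le_tsum (fun j => ?_) ((summable_nat_add_iff n).mpr hsum)
        have h3 : 1 ≤ hilb a W (g * (j + n)) :=
          hn _ ((Nat.le_add_left n j).trans (Nat.le_mul_of_pos_left _ hg)) ⟨_, rfl⟩
        have h4 : (1 : ℝ) ≤ hilb a W (g * (j + n)) := by exact_mod_cast h3
        have h5 : t ^ (g * n) * (t ^ g) ^ j = t ^ (g * (j + n)) := by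
          rw [← pow_mul, ← pow_add]; ring_nf
        rw [h5]
        exact le_mul_of_one_le_left (pow_nonneg ht.1.le _) h4
      refine h2.trans (le_add_of_nonneg_left (Finset.sum_nonneg fun j _ => ?_))
      have := ht.1
      positivity
    calc t ^ (g * n) * ((1 - t) / (1 - t ^ g)) = (1 - t) * (t ^ (g * n) / (1 - t ^ g)) := by ring
      _ ≤ _ := mul_le_mul_of_nonneg_left h1 (sub_nonneg.mpr ht.2.le)
  · filter_upwards [eventually_mem_Ioo] with t ht
    have htg : t ^ g < 1 := pow_lt_one₀ ht.1.le ht.2 hg.ne'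
    have htg0 : 0 ≤ t ^ g := pow_nonneg ht.1.le g
    have hgeo := summable_geometric_of_lt_one htg0 htg
    have hsum : Summable fun j => (hilb a W (g * j) : ℝ) * t ^ (g * j) :=
      (summable_hilb ha W ht.1.le ht.2).comp_injective hinj
    rw [div_eq_mul_inv, ← tsum_geometric_of_lt_one htg0 htg, hser]
    refine mul_le_mul_of_nonneg_left ?_ (sub_nonneg.mpr ht.2.le)
    refine hsum.tsum_le_tsum (fun j => ?_) hgeo
    rw [← pow_mul]
    have h3 : (hilb a W (g * j) : ℝ) ≤ 1 := by exact_mod_cast hle _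
    exact mul_le_of_le_one_left (pow_nonneg ht.1.le _) h3

theorem ratCast_finsum_cycle (k : ℕ) (J : Ideal (MvPolynomial (Fin m) ℂ))
    (E : PrimeSpectrum (MvPolynomial (Fin m) ℂ) → ℚ) :
    ((∑ᶠ W, (fundamentalCycle k J W : ℚ) * E W : ℚ) : ℝ) =
      ∑ᶠ W, (fundamentalCycle k J W : ℝ) * (E W : ℝ) := by
  have h := (Rat.castHom ℝ).toAddMonoidHom.map_finsum (finite_support_cycle_mul k J E)
  refine h.trans (finsum_congr fun W => ?_)
  change (((fundamentalCycle k J W : ℚ) * E W : ℚ) : ℝ) = _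
  rw [Rat.cast_mul, Rat.cast_natCast]

/-- The intersection number of an integral closed substack of dimension `r` is the leading
coefficient of the Hilbert series of its affine cone. -/
theorem tendsto_hilbSeries_intersectionNumber (ha : ∀ i, 0 < a i) (r : ℕ)
    (Z : PrimeSpectrum (MvPolynomial (Fin m) ℂ)) (hZ : IsWHom a Z.asIdeal)
    (hd : affineDim Z.asIdeal = r + 1) :
    Tendsto (fun t => (1 - t) ^ (r + 1) * hilbSeries a Z.asIdeal t) (𝓝[<] 1)
      (𝓝 (intersectionNumber a r Z : ℝ)) := by
  induction r using Nat.strong_induction_on generalizing Z with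
  | _ r ih =>
  rcases r with _ | r
  · have h := tendsto_hilbSeries_of_affineDim_eq_one ha Z.2 hZ hd
    simp only [zero_add, pow_one, intersectionNumber]
    push_cast
    exact h
  have hex := exists_X_notMem_of_affineDim_ne_zero (W := Z.asIdeal) (by omega)
  -- Only `X i ∉ Z` is used about the chosen coordinate, so no independence of the choice has to be
  -- proved beforehand.
  obtain ⟨i, hi, hint⟩ : ∃ i, X i ∉ Z.asIdeal ∧ intersectionNumber a (r + 1) Z =
      (1 / (a i : ℚ)) * ∑ᶠ W, (fundamentalCycle (r + 1) (Z.asIdeal ⊔ Ideal.span {X i}) W : ℚ) *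
        intersectionNumber a r W := by
    refine ⟨hex.choose, hex.choose_spec, ?_⟩
    rw [intersectionNumber, dif_pos hex]
  have hJ := hZ.sup_span (isWeightedHomogeneous_X ℂ a i)
  have hlim := tendsto_hilbSeries_of_primes ha (k := r + 1)
    (E := fun W => (intersectionNumber a r W : ℝ)) (fun W hW hWd => ih r (by omega) W hW hWd)
    ?_ hJ (affineDim_sup_X_le Z.2 hi hd)
  · have h1 := (tendsto_one_sub_div (ha i)).mul hlim
    have h2 : (intersectionNumber a (r + 1) Z : ℝ) = 1 / (a i : ℝ) *
        ∑ᶠ W, (fundamentalCycle (r + 1) (Z.asIdeal ⊔ Ideal.span {X i}) W : ℝ) *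
          (intersectionNumber a r W : ℝ) := by
      rw [hint, Rat.cast_mul, Rat.cast_div, Rat.cast_one, Rat.cast_natCast]
      rw [ratCast_finsum_cycle]
    rw [h2]
    refine h1.congr' ?_
    filter_upwards [eventually_mem_Ioo] with t ht
    rw [hilbSeries_prime_sup_X ha Z.2 hZ hi ht.1.le ht.2]
    have h3 : 1 - t ^ a i ≠ 0 := (sub_pos.mpr (pow_lt_one₀ ht.1.le ht.2 (ha i).ne')).ne'
    field_simp
    ring
  -- Primes of lower dimension do not contribute: their series has a pole of smaller order, by the
  -- induction hypothesis, or is `1` for the irrelevant ideal.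
  · intro W hW hWd
    rcases hdim : affineDim W.asIdeal with _ | j
    · rw [eq_irrelevant_of_affineDim_eq_zero ha hW W.2 hdim]
      simp only [hilbSeries_irrelevant, mul_one]
      exact tendsto_one_sub_pow (Nat.succ_ne_zero r)
    · have h1 := (tendsto_one_sub_pow (e := r - j) (by omega)).mul (ih j (by omega) W hW hdim)
      rw [zero_mul] at h1
      refine h1.congr fun t => ?_
      rw [← mul_assoc, ← pow_add, show r - j + (j + 1) = r + 1 by omega]

end Degree

/-! ### The weighted tangent cone -/

theorem finiteDimensional_finsetSup {V : Type*} [AddCommGroup V] [Module ℂ V] {ι : Type*}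
    (s : Finset ι) {S : ι → Submodule ℂ V} (hS : ∀ i, FiniteDimensional ℂ (S i)) :
    FiniteDimensional ℂ (s.sup S : Submodule ℂ V) := by
  classical
  induction s using Finset.induction_on with
  | empty => rw [Finset.sup_empty]; infer_instance
  | insert i s _ ih => rw [Finset.sup_insert]; infer_instance

theorem finrank_finsetSup_le {V : Type*} [AddCommGroup V] [Module ℂ V] {ι : Type*}
    (s : Finset ι) {S : ι → Submodule ℂ V} (hS : ∀ i, FiniteDimensional ℂ (S i)) :
    Module.finrank ℂ (s.sup S : Submodule ℂ V) ≤ ∑ i ∈ s, Module.finrank ℂ (S i) := by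
  classical
  induction s using Finset.induction_on with
  | empty => rw [Finset.sup_empty, finrank_bot]; exact Nat.zero_le _
  | insert i s hi ih =>
    have := finiteDimensional_finsetSup s hS
    rw [Finset.sup_insert, Finset.sum_insert hi]
    exact (Submodule.finrank_add_le_finrank_add_finrank _ _).trans (Nat.add_le_add_left ih _)

section TangentCone

variable {m : ℕ} {w : Fin m → ℕ} {I : Ideal (MvPolynomial (Fin m) ℂ)}

theorem isWHom_tangentConeIdeal : IsWHom w (tangentConeIdeal w I) := by
  let _ := weightedGradedAlgebra ℂ w
  rw [isWHom_iff]
  refine Ideal.homogeneous_span _ _ ?_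
  rintro _ ⟨f, -, d, -, rfl⟩
  exact ⟨d, weightedHomogeneousComponent_mem _ _ _⟩

theorem component_mem_tangentConeIdeal {f : MvPolynomial (Fin m) ℂ} (hf : f ∈ I) {d : ℕ}
    (h : ∀ e < d, weightedHomogeneousComponent w e f = 0) :
    weightedHomogeneousComponent w d f ∈ tangentConeIdeal w I :=
  Ideal.subset_span ⟨f, hf, d, h, rfl⟩

theorem exists_quotientPart_section (w : Fin m → ℕ) (J : Ideal (MvPolynomial (Fin m) ℂ)) (d : ℕ) :
    ∃ σ : quotientPart w J d →ₗ[ℂ] MvPolynomial (Fin m) ℂ,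
      ∀ x, IsWeightedHomogeneous w (σ x) d ∧ Ideal.Quotient.mk J (σ x) = x := by
  let L : weightedHomogeneousSubmodule ℂ w d →ₗ[ℂ] quotientPart w J d :=
    (Ideal.Quotient.mkₐ ℂ J).toLinearMap.restrict fun f hf => ⟨f, hf, rfl⟩
  have hL : LinearMap.range L = ⊤ := by
    rw [LinearMap.range_eq_top]
    rintro ⟨_, f, hf, rfl⟩
    exact ⟨⟨f, hf⟩, rfl⟩
  obtain ⟨σ, hσ⟩ := L.exists_rightInverse_of_surjective hL
  refine ⟨(weightedHomogeneousSubmodule ℂ w d).subtype ∘ₗ σ, fun x => ⟨(σ x).2, ?_⟩⟩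
  exact congrArg Subtype.val (LinearMap.congr_fun hσ x)

/-- The polynomials of weighted degree at most `N` span a large subspace of the coordinate ring
of a scheme whose weighted tangent cone is large. -/
theorem sum_hilb_tangentConeIdeal_le (hw : ∀ i, 0 < w i) (N : ℕ)
    (G : Submodule ℂ (MvPolynomial (Fin m) ℂ ⧸ I)) [FiniteDimensional ℂ G]
    (hG : ∀ d ≤ N, ∀ f, IsWeightedHomogeneous w f d → Ideal.Quotient.mk I f ∈ G) :
    ∑ d ∈ Finset.range (N + 1), hilb w (tangentConeIdeal w I) d ≤ Module.finrank ℂ G := by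
  classical
  set T := tangentConeIdeal w I
  choose σ hσ using exists_quotientPart_section w T
  have hfd : ∀ d, FiniteDimensional ℂ (quotientPart w T d) := finiteDimensional_quotientPart hw
  let Ψ : (∀ d : Fin (N + 1), quotientPart w T d) →ₗ[ℂ] MvPolynomial (Fin m) ℂ :=
    ∑ d : Fin (N + 1), σ d ∘ₗ LinearMap.proj d
  have hΨ : ∀ x, Ψ x = ∑ d : Fin (N + 1), σ d (x d) := fun x => by
    simp only [Ψ, LinearMap.sum_apply, LinearMap.comp_apply, LinearMap.proj_apply]
  have hcomp : ∀ x (d : Fin (N + 1)), weightedHomogeneousComponent w d (Ψ x) = σ d (x d) := by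
    intro x d
    rw [hΨ, map_sum, Finset.sum_eq_single d]
    · exact weightedHomogeneousComponent_eq_self (hσ d (x d)).1
    · intro e _ he
      rw [weightedHomogeneousComponent_of_mem (hσ e (x e)).1, if_neg fun h => he (Fin.ext h).symm]
    · exact fun h => absurd (Finset.mem_univ _) h
  have hΨG : ∀ x, ((Ideal.Quotient.mkₐ ℂ I).toLinearMap ∘ₗ Ψ) x ∈ G := by
    intro x
    rw [LinearMap.comp_apply, hΨ, map_sum]
    exact Submodule.sum_mem _ fun d _ => hG d (Nat.lt_succ_iff.mp d.2) _ (hσ d (x d)).1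
  have hinj : Function.Injective (LinearMap.codRestrict G _ hΨG) := by
    rw [← LinearMap.ker_eq_bot, LinearMap.ker_eq_bot']
    intro x hx
    have hxI : Ψ x ∈ I := Ideal.Quotient.eq_zero_iff_mem.mp (congrArg Subtype.val hx)
    -- If the components below `k` vanish, the component of degree `k` is a lowest part of an
    -- element of `I`, so it lies in `T` and its class `x k` is zero.
    suffices h : ∀ k (hk : k < N + 1), x ⟨k, hk⟩ = 0 from funext fun d => h d d.2
    intro k
    induction k using Nat.strong_induction_on with
    | _ k ih =>
    intro hk
    have h1 : weightedHomogeneousComponent w k (Ψ x) ∈ T := by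
      refine component_mem_tangentConeIdeal hxI fun e he => ?_
      have h2 := hcomp x ⟨e, he.trans hk⟩
      rw [ih e he, map_zero] at h2
      exact h2
    rw [hcomp x ⟨k, hk⟩] at h1
    refine Subtype.ext ?_
    rw [← (hσ k (x ⟨k, hk⟩)).2]
    exact Ideal.Quotient.eq_zero_iff_mem.mpr h1
  have h := LinearMap.finrank_le_finrank_of_injective hinj
  rw [Module.finrank_pi_fintype] at h
  rw [← Fin.sum_univ_eq_sum_range]
  exact h

/-- If the quotient is finite-dimensional, finitely many graded pieces already span it. Otherwise
`finrank` is `0` by convention and the empty set works. -/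
theorem exists_finrank_quotient_le (hw : ∀ i, 0 < w i) (J : Ideal (MvPolynomial (Fin m) ℂ)) :
    ∃ s : Finset ℕ, Module.finrank ℂ (MvPolynomial (Fin m) ℂ ⧸ J) ≤ ∑ d ∈ s, hilb w J d := by
  by_cases hfin : Module.Finite ℂ (MvPolynomial (Fin m) ℂ ⧸ J)
  · have hfd : ∀ d, FiniteDimensional ℂ (quotientPart w J d) := finiteDimensional_quotientPart hw
    have htop : (⊤ : Submodule ℂ (MvPolynomial (Fin m) ℂ ⧸ J)) ≤ ⨆ d, quotientPart w J d := by
      rintro x -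
      obtain ⟨f, rfl⟩ := Ideal.Quotient.mk_surjective x
      rw [f.as_sum, map_sum]
      refine Submodule.sum_mem _ fun u _ => ?_
      exact Submodule.mem_iSup_of_mem (Finsupp.weight w u)
        ⟨_, isWeightedHomogeneous_monomial w u _ rfl, rfl⟩
    obtain ⟨s, hs⟩ := CompleteLattice.IsCompactElement.exists_finset_of_le_iSup _
      ((Submodule.fg_iff_compact _).mp hfin.fg_top) _ htop
    rw [← Finset.sup_eq_iSup] at hs
    refine ⟨s, le_trans ?_ (finrank_finsetSup_le s hfd)⟩
    rw [← finrank_top ℂ (MvPolynomial (Fin m) ℂ ⧸ J)]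
    exact Submodule.finrank_mono hs
  · exact ⟨∅, by rw [Module.finrank_of_not_finite hfin]; exact Nat.zero_le _⟩

end TangentCone

/-! ### Dehomogenization -/

section Chart

variable {n : ℕ} {a : Fin (n + 2) → ℕ}

/-- Dehomogenization with respect to the last variable. -/
def dehomogenize (n : ℕ) : MvPolynomial (Fin (n + 2)) ℂ →ₐ[ℂ] MvPolynomial (Fin (n + 1)) ℂ :=
  aeval (Fin.snoc (α := fun _ => MvPolynomial (Fin (n + 1)) ℂ) X 1)

theorem exists_dehomogenize_eq {f : MvPolynomial (Fin (n + 1)) ℂ} {d : ℕ}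
    (hf : IsWeightedHomogeneous (fun i => a i.castSucc) f d) (k : ℕ) :
    ∃ F, IsWeightedHomogeneous a F (d + k * a (Fin.last (n + 1))) ∧ dehomogenize n F = f := by
  refine ⟨rename Fin.castSucc f * X (Fin.last (n + 1)) ^ k, ?_, ?_⟩
  · refine IsWeightedHomogeneous.mul ?_ ((isWeightedHomogeneous_X ℂ a _).pow k)
    intro e he
    obtain ⟨u, rfl, hu⟩ := coeff_rename_ne_zero _ _ _ he
    rw [← hf hu, Finsupp.weight_apply, Finsupp.weight_apply,
      Finsupp.sum_mapDomain_index (by simp) (by intros; rw [add_smul])]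
  · rw [map_mul, map_pow, dehomogenize, aeval_X, Fin.snoc_last, one_pow, mul_one, aeval_rename]
    have h : (Fin.snoc (α := fun _ => MvPolynomial (Fin (n + 1)) ℂ) X 1 ∘ Fin.castSucc) = X := by
      ext1 i
      rw [Function.comp_apply, Fin.snoc_castSucc]
    rw [h, aeval_X_left, AlgHom.id_apply]

/-- Everything of weight at most `N` in the chart is the dehomogenization of forms with degrees in a
window of length `a_{n+1}` ending at `N`. -/
theorem sum_hilb_tangentConeIdeal_chart_le (ha : ∀ i, 0 < a i)
    (P : Ideal (MvPolynomial (Fin (n + 2)) ℂ)) (N : ℕ) :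
    ∑ d ∈ Finset.range (N + 1),
      hilb (fun i => a i.castSucc)
        (tangentConeIdeal (fun i => a i.castSucc) (P.map (dehomogenize n))) d ≤
      ∑ d ∈ (Finset.range (N + 1)).filter (fun d => N < d + a (Fin.last (n + 1))), hilb a P d := by
  set I := P.map (dehomogenize n)
  let s := (Finset.range (N + 1)).filter fun d => N < d + a (Fin.last (n + 1))
  let φ : (MvPolynomial (Fin (n + 2)) ℂ ⧸ P) →ₐ[ℂ] MvPolynomial (Fin (n + 1)) ℂ ⧸ I :=
    Ideal.quotientMapₐ I (dehomogenize n) Ideal.le_comap_map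
  let S : ℕ → Submodule ℂ (MvPolynomial (Fin (n + 1)) ℂ ⧸ I) :=
    fun d => (quotientPart a P d).map φ.toLinearMap
  have hfd : ∀ d, FiniteDimensional ℂ (quotientPart a P d) := finiteDimensional_quotientPart ha
  have hS : ∀ d, FiniteDimensional ℂ (S d) := fun d => inferInstanceAs
    (FiniteDimensional ℂ ((quotientPart a P d).map φ.toLinearMap))
  have := finiteDimensional_finsetSup s hS
  refine (sum_hilb_tangentConeIdeal_le (fun i => ha i.castSucc) N (s.sup S) ?_).trans
    ((finrank_finsetSup_le s hS).trans (Finset.sum_le_sum fun d _ => ?_))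
  · intro d hd f hf
    have hb := ha (Fin.last (n + 1))
    set b := a (Fin.last (n + 1))
    -- The exponent `(N - d) / b` raises the degree to the largest number at most `N` congruent to
    -- `d` modulo `b`, which lies in the window.
    obtain ⟨F, hF, rfl⟩ := exists_dehomogenize_eq hf ((N - d) / b)
    have h1 := Nat.div_add_mod (N - d) b
    have h2 := Nat.mod_lt (N - d) hb
    rw [mul_comm] at h1
    have hmem : d + (N - d) / b * b ∈ s := by
      refine Finset.mem_filter.mpr ⟨Finset.mem_range.mpr ?_, ?_⟩ <;> omega
    exact (Finset.le_sup (f := S) hmem) ⟨Ideal.Quotient.mk P F, ⟨F, hF, rfl⟩, rfl⟩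
  · exact Submodule.finrank_map_le _ _

/-! ### Abel summation and comparison of Hilbert series -/

theorem sum_mul_pow_nonneg_of_partial_sums {u : ℕ → ℝ}
    (hu : ∀ N, 0 ≤ ∑ d ∈ Finset.range (N + 1), u d) {t : ℝ} (h0 : 0 ≤ t) (h1 : t ≤ 1) (N : ℕ) :
    (∑ d ∈ Finset.range (N + 1), u d) * t ^ N ≤ ∑ d ∈ Finset.range (N + 1), u d * t ^ d := by
  induction N with
  | zero => simp
  | succ N ih =>
    rw [Finset.sum_range_succ, Finset.sum_range_succ (fun d => u d * t ^ d), add_mul]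
    refine add_le_add_left (le_trans ?_ ih) _
    exact mul_le_mul_of_nonneg_left (pow_le_pow_of_le_one h0 h1 (Nat.le_succ N)) (hu N)

theorem tsum_mul_pow_nonneg {u : ℕ → ℝ} (hu : ∀ N, 0 ≤ ∑ d ∈ Finset.range (N + 1), u d)
    {t : ℝ} (h0 : 0 ≤ t) (h1 : t ≤ 1) (hs : Summable fun d => u d * t ^ d) :
    0 ≤ ∑' d, u d * t ^ d := by
  refine ge_of_tendsto ((Filter.tendsto_add_atTop_iff_nat 1).mpr hs.hasSum.tendsto_sum_nat) ?_
  refine Filter.Eventually.of_forall fun N => ?_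
  exact (mul_nonneg (hu N) (pow_nonneg h0 N)).trans (sum_mul_pow_nonneg_of_partial_sums hu h0 h1 N)

/-- The summands on the left are the coefficients of `(1 - t^b) ∑ h(d) t^d`; their partial sums
telescope to the last `b` values. -/
theorem sum_range_sub_shift (h : ℕ → ℝ) (b N : ℕ) :
    ∑ d ∈ Finset.range (N + 1), (h d - if b ≤ d then h (d - b) else 0) =
      ∑ d ∈ (Finset.range (N + 1)).filter (fun d => N < d + b), h d := by
  rw [Finset.sum_sub_distrib, ← Finset.sum_filter,
    ← Finset.sum_filter_add_sum_filter_not (Finset.range (N + 1)) (fun d => N < d + b) h,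
    add_sub_assoc, add_eq_left, sub_eq_zero]
  refine Finset.sum_nbij' (· + b) (· - b) ?_ ?_ ?_ ?_ ?_ <;>
    simp only [Finset.mem_filter, Finset.mem_range]
  · intro d hd; omega
  · intro d hd; omega
  · intro d _; omega
  · intro d hd; omega
  · intro d _; rw [Nat.add_sub_cancel]

/-- The Hilbert series of the weighted tangent cone at the origin of the chart is bounded by the
Hilbert series of the hyperplane section at infinity. -/
theorem hilbSeries_tangentConeIdeal_le (ha : ∀ i, 0 < a i)
    (P : Ideal (MvPolynomial (Fin (n + 2)) ℂ)) {t : ℝ} (h0 : 0 ≤ t) (h1 : t < 1) :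
    hilbSeries (fun i => a i.castSucc)
      (tangentConeIdeal (fun i => a i.castSucc) (P.map (dehomogenize n))) t ≤
      (1 - t ^ a (Fin.last (n + 1))) * hilbSeries a P t := by
  have hN := sum_hilb_tangentConeIdeal_chart_le ha P
  generalize a (Fin.last (n + 1)) = b at hN ⊢
  have hP := summable_hilb ha P h0 h1
  have hT := summable_hilb (fun i : Fin (n + 1) => ha i.castSucc)
    (tangentConeIdeal (fun i => a i.castSucc) (P.map (dehomogenize n))) h0 h1
  unfold hilbSeries
  generalize hilb (fun i => a i.castSucc)
    (tangentConeIdeal (fun i => a i.castSucc) (P.map (dehomogenize n))) = c at hN hT ⊢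
  generalize hilb a P = h at hN hP ⊢
  have hshift : HasSum (fun d => (if b ≤ d then (h (d - b) : ℝ) else 0) * t ^ d)
      (t ^ b * ∑' d, (h d : ℝ) * t ^ d) := by
    rw [← hasSum_nat_add_iff' b]
    have h2 : ∑ d ∈ Finset.range b, (if b ≤ d then (h (d - b) : ℝ) else 0) * t ^ d = 0 :=
      Finset.sum_eq_zero fun d hd => by
        rw [if_neg (not_le.mpr (Finset.mem_range.mp hd)), zero_mul]
    rw [h2, sub_zero]
    refine (hP.hasSum.mul_left (t ^ b)).congr_fun fun d => ?_
    rw [if_pos (Nat.le_add_left b d), Nat.add_sub_cancel, pow_add]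
    ring
  have hsum := (hP.hasSum.sub hshift).sub hT.hasSum
  -- `u` is the coefficient sequence of `(1 - t^b) Hilb_P - Hilb_T`. Its terms may be negative, but
  -- its partial sums are not.
  have hnn := tsum_mul_pow_nonneg (t := t)
    (u := fun d => ((h d : ℝ) - if b ≤ d then (h (d - b) : ℝ) else 0) - c d) ?_ h0 h1.le ?_
  · have h3 : ∑' d, (((h d : ℝ) - if b ≤ d then (h (d - b) : ℝ) else 0) - c d) * t ^ d =
        (∑' d, (h d : ℝ) * t ^ d) - t ^ b * (∑' d, (h d : ℝ) * t ^ d) -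
          ∑' d, (c d : ℝ) * t ^ d := by
      rw [← hsum.tsum_eq]
      exact tsum_congr fun d => by ring
    rw [h3] at hnn
    linarith
  · intro N
    rw [Finset.sum_sub_distrib, sum_range_sub_shift (fun d => (h d : ℝ)), sub_nonneg]
    exact_mod_cast hN N
  · refine hsum.summable.congr fun d => ?_
    ring

end Chart

open Filter Topology in
/-- The weighted multiplicity at the origin of the chart is bounded by the degree. -/
theorem weightedMultiplicity_chartIdeal_le (n : ℕ) (a : Fin (n + 2) → ℕ) (ha : ∀ i, 0 < a i)
    (S : WeightedStack.IntegralClosedSubstack a) :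
    WeightedStack.weightedMultiplicity (fun i : Fin (n + 1) => a i.castSucc) S.dim S.chartIdeal
      ≤ (a (Fin.last (n + 1)) : ℚ) * S.degree := by
  have hw : ∀ i : Fin (n + 1), 0 < a i.castSucc := fun i => ha i.castSucc
  have hS : IsWHom a S.cone.asIdeal := S.isHomogeneous
  obtain ⟨i, hi⟩ := S.exists_X_notMem
  -- The truncated subtraction in `dim` is harmless: a coordinate outside the ideal makes the cone
  -- of positive dimension.
  have hdim : affineDim S.cone.asIdeal = S.dim + 1 :=
    (Nat.sub_add_cancel (affineDim_pos_of_X_notMem ha hS S.isPrime hi)).symm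
  have hlim := (tendsto_one_sub_pow_div (a (Fin.last (n + 1)))).mul
    (tendsto_hilbSeries_intersectionNumber ha S.dim S.cone hS hdim)
  have hle : ∀ t : ℝ, 0 < t → t < 1 → (1 - t) ^ S.dim * hilbSeries (fun i => a i.castSucc)
      (tangentConeIdeal (fun i => a i.castSucc) S.chartIdeal) t ≤
      (1 - t ^ a (Fin.last (n + 1))) / (1 - t) *
        ((1 - t) ^ (S.dim + 1) * hilbSeries a S.cone.asIdeal t) := by
    intro t h0 h1
    have h2 : 1 - t ≠ 0 := (sub_pos.mpr h1).ne'
    refine (mul_le_mul_of_nonneg_left (hilbSeries_tangentConeIdeal_le ha S.ideal h0.le h1)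
      (pow_nonneg (sub_pos.mpr h1).le _)).trans_eq ?_
    rw [pow_succ]
    field_simp
    rfl
  have hdeg : S.degree = intersectionNumber a S.dim S.cone := rfl
  rw [← Rat.cast_le (K := ℝ), hdeg, Rat.cast_mul, Rat.cast_natCast]
  generalize intersectionNumber a S.dim S.cone = D at hlim ⊢
  generalize S.dim = r at hlim hle ⊢
  rcases r with _ | r
  -- For `r = 0` the multiplicity is a vector space dimension, bounded by a finite sum of Hilbert
  -- values; truncate the series to these degrees before letting `t → 1`.
  · obtain ⟨s, hs⟩ := exists_finrank_quotient_le hw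
      (tangentConeIdeal (fun i => a i.castSucc) S.chartIdeal)
    have h1 : Tendsto (fun t : ℝ => ∑ d ∈ s, (hilb (fun i => a i.castSucc)
        (tangentConeIdeal (fun i => a i.castSucc) S.chartIdeal) d : ℝ) * t ^ d) (𝓝[<] 1)
        (𝓝 (∑ d ∈ s, (hilb (fun i => a i.castSucc)
        (tangentConeIdeal (fun i => a i.castSucc) S.chartIdeal) d : ℝ) * 1)) :=
      tendsto_finsetSum _ fun d _ => (tendsto_pow_nhdsLT_one d).const_mul _
    have h2 := le_of_tendsto_of_tendsto h1 hlim (by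
      filter_upwards [eventually_mem_Ioo] with t ht
      refine le_trans ?_ (hle t ht.1 ht.2)
      rw [pow_zero, one_mul]
      exact sum_hilb_le_hilbSeries hw _ ht.1.le ht.2 s)
    simp only [mul_one] at h2
    refine le_trans ?_ h2
    rw [weightedMultiplicity, Rat.cast_natCast]
    exact_mod_cast hs
  · rw [weightedMultiplicity, ratCast_finsum_cycle]
    exact finsum_cycle_le_of_tendsto hw
      (fun W hW hWd => tendsto_hilbSeries_intersectionNumber hw r W hW hWd)
      isWHom_tangentConeIdeal hlim hle

end WeightedStack

end

theorem lemma4p4 (n : ℕ) (a : Fin (n + 2) → ℕ) (ha : ∀ i, 0 < a i)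
    (S : WeightedStack.IntegralClosedSubstack a) :
    WeightedStack.weightedMultiplicity (fun i : Fin (n + 1) => a i.castSucc) S.dim S.chartIdeal
      ≤ (a (Fin.last (n + 1)) : ℚ) * S.degree :=
  WeightedStack.weightedMultiplicity_chartIdeal_le n a ha S
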